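/- Let $\mathcal V$ be an arbitrary set (of variables). Formulae are built from the atomic formulae $x\le y$ ($x,y\in\mathcal V$) and $\top$ by the binary operation $\wedge$. The category $S_\le$ has formulae as objects. Its arrow terms $f:A\vdash B$ are built from $$\mathbf 1_A:A\vdash A,\qquad b^{\to}_{A,B,C}:A\wedge(B\wedge C)\vdash(A\wedge B)\wedge C,\qquad b^{\leftarrow}_{A,B,C}:(A\wedge B)\wedge C\vdash A\wedge(B\wedge C),$$ $$\delta^{\to}_A:A\wedge\top\vdash A,\quad \delta^{\leftarrow}_A:A\vdash A\wedge\top,\quad \sigma^{\to}_A:\top\wedge A\vdash A,\quad \sigma^{\leftarrow}_A:A\vdash\top\wedge A,$$ $$c_{A,B}:A\wedge B\vdash B\wedge A,\qquad r_x:\top\vdash x\le x,\qquad t_{x,y,z}:x\le y\wedge y\le z\vdash x\le z$$ by composition $g\circ f$ and by $f\wedge g:A\wedge C\vdash B\wedge D$ for $f:A\vdash B$, $g:C\vdash D$. The arrows of $S_\le$ are the arrow terms modulo the smallest congruence (with respect to $\circ$ and $\wedge$) that contains the equations of a category, the bifunctoriality of $\wedge$, the naturality of $b^{\to},\delta^{\to},\sigma^{\to},c$,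 the equations stating that $b^{\leftarrow},\delta^{\leftarrow},\sigma^{\leftarrow}$ are inverse to $b^{\to},\delta^{\to},\sigma^{\to}$, the pentagon and the triangle $$b^{\to}_{A\wedge B,C,D}\circ b^{\to}_{A,B,C\wedge D}=(b^{\to}_{A,B,C}\wedge\mathbf 1_D)\circ b^{\to}_{A,B\wedge C,D}\circ(\mathbf 1_A\wedge b^{\to}_{B,C,D}),\qquad b^{\to}_{A,\top,C}=(\delta^{\leftarrow}_A\wedge\mathbf 1_C)\circ(\mathbf 1_A\wedge\sigma^{\to}_C),$$ the symmetry equations $$c_{B,A}\circ c_{A,B}=\mathbf 1_{A\wedge B},\qquad c_{A,B\wedge C}=b^{\to}_{B,C,A}\circ(\mathbf 1_B\wedge c_{A,C})\circ b^{\leftarrow}_{B,A,C}\circ(c_{A,B}\wedge\mathbf 1_C)\circ b^{\to}_{A,B,C},$$ and the equations $$t_{x,y,y}\circ(\mathbf 1_{x\le y}\wedge r_y)=\delta^{\to}_{x\le y},\qquad t_{y,y,x}\circ(r_y\wedge\mathbf 1_{y\le x})=\sigma^{\to}_{y\le x},$$ $$t_{x,y,u}\circ(\mathbf 1_{x\le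 y}\wedge t_{y,z,u})=t_{x,z,u}\circ(t_{x,y,z}\wedge\mathbf 1_{z\le u})\circ b^{\to}_{x\le y,y\le z,z\le u}.$$ Let $\mathrm{Br}$ be the category whose objects are the finite ordinals and whose arrows $m\to n$ are the equivalence relations on the disjoint union $m+n$ all of whose classes have exactly two members (diagrams of lines, cups and caps). The composite of $R:m\to n$ and $P:n\to k$ is the restriction to $m+k$ of the equivalence relation on $m+n+k$ generated by $R$ and $P$; the identity on $m$ joins each element of the source to the same element of the target. There is a functor $G:S_\le\to\mathrm{Br}$ that sends a formula to its number of occurrences of variables and sends an arrow to the diagram in which: $\mathbf 1$, $b^{\to}$, $b^{\leftarrow}$, $\delta^{\to}$, $\delta^{\leftarrow}$, $\sigma^{\to}$, $\sigma^{\leftarrow}$ are order-preserving families of parallel lines; $c_{A,B}$ is the crossing that exchanges the block of lines of $A$ with that of $B$; $r_x$ is a cap joining the two occurrences of $x$; $t_{x,y,z}$ is a cup joining the two occurrences of $y$ together with a line joining the two occurrences of $x$ and a line joining the two occurrences of $z$; $\circ$ is vertical composition and $\wedge$ is horizontal composition (juxtaposition) of diagrams. **Theorem (coherence of $S_\le$).**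 For every set $\mathcal V$ the functor $G:S_\le\to\mathrm{Br}$ is faithful: if $f,g:A\vdash B$ are arrow terms with $Gf=Gg$, then $f=g$ in $S_\le$. -/

import Mathlib

/-! ## Formulae and arrow terms -/

/-- Formulae over a set `V` of variables: `x ≤ y`, `⊤` and `A ∧ B`. -/
inductive Formula (V : Type*) where
  | le (x y : V) : Formula V
  | top : Formula V
  | conj (A B : Formula V) : Formula V

namespace Formula

/-- The number of occurrences of variables in a formula. -/
def size {V : Type*} : Formula V → ℕ
  | le _ _ => 2
  | top => 0
  | conj A B => A.size + B.size

end Formula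

open Formula in
/-- Arrow terms `f : A ⊢ B`. Composition is written in the order `g ∘ f`. -/
inductive ArrowTerm {V : Type*} : Formula V → Formula V → Type _ where
  | one (A : Formula V) : ArrowTerm A A
  | bR (A B C : Formula V) : ArrowTerm (conj A (conj B C)) (conj (conj A B) C)
  | bL (A B C : Formula V) : ArrowTerm (conj (conj A B) C) (conj A (conj B C))
  | deltaR (A : Formula V) : ArrowTerm (conj A top) A
  | deltaL (A : Formula V) : ArrowTerm A (conj A top)
  | sigmaR (A : Formula V) : ArrowTerm (conj top A) A
  | sigmaL (A : Formula V) : ArrowTerm A (conj top A)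
  | r (x : V) : ArrowTerm top (le x x)
  | t (x y z : V) : ArrowTerm (conj (le x y) (le y z)) (le x z)
  | c (A B : Formula V) : ArrowTerm (conj A B) (conj B A)
  | and {A B C D : Formula V} (f : ArrowTerm A B) (g : ArrowTerm C D) :
      ArrowTerm (conj A C) (conj B D)
  | comp {A B C : Formula V} (g : ArrowTerm B C) (f : ArrowTerm A B) : ArrowTerm A C

/-- Composition of arrow terms. -/
infixr:80 " ⊚ " => ArrowTerm.comp
/-- Conjunction of arrow terms. -/
infixr:85 " ⋏ " => ArrowTerm.and

open Formula ArrowTerm in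
/-- The equality of arrow terms of `S_≤`: the smallest congruence that contains the categorial,
bifunctoriality and naturality equations, the equations of symmetric monoidal categories, and the
three equations for `r` and `t`. -/
inductive ArrowTerm.Equal {V : Type*} :
    ∀ {A B : Formula V}, ArrowTerm A B → ArrowTerm A B → Prop
  -- equivalence relation
  | refl {A B : Formula V} (f : ArrowTerm A B) : Equal f f
  | symm {A B : Formula V} {f g : ArrowTerm A B} : Equal f g → Equal g f
  | trans {A B : Formula V} {f g h : ArrowTerm A B} : Equal f g → Equal g h → Equal f h
  -- congruence
  | and_congr {A B C D : Formula V} {f₁ g₁ : ArrowTerm A B} {f₂ g₂ : ArrowTerm C D} :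
      Equal f₁ g₁ → Equal f₂ g₂ → Equal (f₁ ⋏ f₂) (g₁ ⋏ g₂)
  | comp_congr {A B C : Formula V} {f₁ g₁ : ArrowTerm A B} {f₂ g₂ : ArrowTerm B C} :
      Equal f₁ g₁ → Equal f₂ g₂ → Equal (f₂ ⊚ f₁) (g₂ ⊚ g₁)
  -- categorial equations
  | one_comp {A B : Formula V} (f : ArrowTerm A B) : Equal (one B ⊚ f) f
  | comp_one {A B : Formula V} (f : ArrowTerm A B) : Equal (f ⊚ one A) f
  | assoc {A B C D : Formula V} (h : ArrowTerm C D) (g : ArrowTerm B C) (f : ArrowTerm A B) :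
      Equal ((h ⊚ g) ⊚ f) (h ⊚ (g ⊚ f))
  -- bifunctoriality equations
  | and_one (A B : Formula V) : Equal (one A ⋏ one B) (one (conj A B))
  | and_comp {A₁ B₁ C₁ A₂ B₂ C₂ : Formula V} (g₁ : ArrowTerm B₁ C₁) (f₁ : ArrowTerm A₁ B₁)
      (g₂ : ArrowTerm B₂ C₂) (f₂ : ArrowTerm A₂ B₂) :
      Equal ((g₁ ⊚ f₁) ⋏ (g₂ ⊚ f₂)) ((g₁ ⋏ g₂) ⊚ (f₁ ⋏ f₂))
  -- naturality equations
  | b_nat {A B C D E F : Formula V} (f : ArrowTerm A D) (g : ArrowTerm B E) (h : ArrowTerm C F) :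
      Equal (((f ⋏ g) ⋏ h) ⊚ bR A B C) (bR D E F ⊚ (f ⋏ (g ⋏ h)))
  | delta_nat {A D : Formula V} (f : ArrowTerm A D) :
      Equal (f ⊚ deltaR A) (deltaR D ⊚ (f ⋏ one top))
  | sigma_nat {A D : Formula V} (f : ArrowTerm A D) :
      Equal (f ⊚ sigmaR A) (sigmaR D ⊚ (one top ⋏ f))
  | c_nat {A B D E : Formula V} (f : ArrowTerm A D) (g : ArrowTerm B E) :
      Equal ((g ⋏ f) ⊚ c A B) (c D E ⊚ (f ⋏ g))
  -- specific equations of monoidal categories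
  | bL_bR (A B C : Formula V) : Equal (bL A B C ⊚ bR A B C) (one (conj A (conj B C)))
  | bR_bL (A B C : Formula V) : Equal (bR A B C ⊚ bL A B C) (one (conj (conj A B) C))
  | b5 (A B C D : Formula V) :
      Equal (bR (conj A B) C D ⊚ bR A B (conj C D))
        ((bR A B C ⋏ one D) ⊚ bR A (conj B C) D ⊚ (one A ⋏ bR B C D))
  | deltaL_deltaR (A : Formula V) : Equal (deltaL A ⊚ deltaR A) (one (conj A top))
  | deltaR_deltaL (A : Formula V) : Equal (deltaR A ⊚ deltaL A) (one A)
  | sigmaL_sigmaR (A : Formula V) : Equal (sigmaL A ⊚ sigmaR A) (one (conj top A))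
  | sigmaR_sigmaL (A : Formula V) : Equal (sigmaR A ⊚ sigmaL A) (one A)
  | b_delta_sigma (A C : Formula V) :
      Equal (bR A top C) ((deltaL A ⋏ one C) ⊚ (one A ⋏ sigmaR C))
  -- specific equations of symmetric monoidal categories
  | cc (A B : Formula V) : Equal (c B A ⊚ c A B) (one (conj A B))
  | bc (A B C : Formula V) :
      Equal (c A (conj B C))
        (bR B C A ⊚ (one B ⋏ c A C) ⊚ bL B A C ⊚ (c A B ⋏ one C) ⊚ bR A B C)
  -- equations for `r` and `t`
  | rt_delta (x y : V) :
      Equal (t x y y ⊚ (one (le x y) ⋏ r y)) (deltaR (le x y))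
  | rt_sigma (x y : V) :
      Equal (t y y x ⊚ (r y ⋏ one (le y x))) (sigmaR (le y x))
  | tb (x y z u : V) :
      Equal (t x y u ⊚ (one (le x y) ⋏ t y z u))
        (t x z u ⊚ (t x y z ⋏ one (le z u)) ⊚ bR (le x y) (le y z) (le z u))

/-- Arrow terms of a fixed type, up to equality. -/
instance ArrowTerm.setoid {V : Type*} (A B : Formula V) : Setoid (ArrowTerm A B) where
  r := ArrowTerm.Equal
  iseqv := ⟨.refl, .symm, .trans⟩

/-! ## The category `S_≤` -/

/-- The objects of `S_≤` are the formulae. -/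
def SLe (V : Type*) : Type _ := Formula V

/-- The arrows of `S_≤` are the arrow terms up to equality. -/
instance SLe.category (V : Type*) : CategoryTheory.Category (SLe V) where
  Hom A B := Quotient (ArrowTerm.setoid (V := V) A B)
  id A := Quotient.mk _ (ArrowTerm.one A)
  comp f g := Quotient.map₂ (fun f g => g ⊚ f)
    (fun _ _ h₁ _ _ h₂ => ArrowTerm.Equal.comp_congr h₁ h₂) f g
  id_comp := by
    rintro A B ⟨f⟩
    exact Quotient.sound (ArrowTerm.Equal.comp_one f)
  comp_id := by
    rintro A B ⟨f⟩
    exact Quotient.sound (ArrowTerm.Equal.one_comp f)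
  assoc := by
    rintro A B C D ⟨f⟩ ⟨g⟩ ⟨h⟩
    exact Quotient.sound (ArrowTerm.Equal.symm (ArrowTerm.Equal.assoc h g f))

/-! ## Split equivalences -/

/-- A split equivalence from `X` to `Y`: an equivalence relation on the disjoint union. -/
abbrev Split (X Y : Type*) := Setoid (X ⊕ Y)

namespace Split

variable {X Y Z W X' Y' Z' : Type*}

/-- One step in the diagram obtained by putting `R` on top of `P`. -/
inductive Link (R : Split X Y) (P : Split Y Z) : X ⊕ (Y ⊕ Z) → X ⊕ (Y ⊕ Z) → Prop
  | upper {a b : X ⊕ Y} : R a b → Link R P (Sum.map id Sum.inl a) (Sum.map id Sum.inl b)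
  | lower {a b : Y ⊕ Z} : P a b → Link R P (Sum.inr a) (Sum.inr b)

/-- Vertical composition: the equivalence relation generated on `X ⊕ Y ⊕ Z` by `R` and `P`,
restricted to `X ⊕ Z`. -/
@[reducible] def comp (R : Split X Y) (P : Split Y Z) : Split X Z :=
  (Relation.EqvGen.setoid (Link R P)).comap (Sum.map id Sum.inr)

/-- The family of lines that join `x` to `e x`. -/
@[reducible] def ofEquiv (e : X ≃ Y) : Split X Y := Setoid.ker (Sum.elim e id)

/-- The disjoint union of two equivalence relations. -/
@[reducible] def sum (R : Setoid X) (P : Setoid Y) : Setoid (X ⊕ Y) where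
  r := Sum.LiftRel R P
  iseqv := ⟨by rintro (a | a) <;> simp,
    by rintro _ _ (h | h) <;> simp [Setoid.symm' _ h],
    by
      rintro _ _ _ (h | h) (h' | h')
      · exact .inl (R.trans' h h')
      · exact .inr (P.trans' h h')⟩

/-- Horizontal composition. -/
@[reducible] def tensor (R : Split X Y) (P : Split X' Y') : Split (X ⊕ X') (Y ⊕ Y') :=
  (sum R P).comap (Equiv.sumSumSumComm X X' Y Y')

/-- A split equivalence is Brauerian when each of its classes has exactly two members. -/
def Brauerian (R : Setoid X) : Prop := ∀ a : X, ∃! b : X, b ≠ a ∧ R a b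

/-! ### Truth assignments that respect a split equivalence -/

/-- The assignments `f` on `X` and `g` on `Y` are constant on the classes of `R`. -/
def Inv (R : Split X Y) (f : X → Prop) (g : Y → Prop) : Prop :=
  ∀ a b, R a b → (Sum.elim f g a ↔ Sum.elim f g b)

theorem ext_inv {R P : Split X Y} (h : ∀ f g, Inv R f g ↔ Inv P f g) : R = P := by
  have key : ∀ {R P : Split X Y}, (∀ f g, Inv P f g → Inv R f g) → ∀ a b, R a b → P a b := by
    intro R P h a b hab
    have h1 : Inv P (fun x => P a (Sum.inl x)) (fun y => P a (Sum.inr y)) := by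
      rintro (u | u) (v | v) huv <;>
        exact ⟨fun w => P.trans' w huv, fun w => P.trans' w (P.symm' huv)⟩
    have h2 := h _ _ h1 a b hab
    have h3 : ∀ w : X ⊕ Y, Sum.elim (fun x => P a (Sum.inl x)) (fun y => P a (Sum.inr y)) w
        ↔ P a w := by rintro (w | w) <;> rfl
    rw [h3, h3] at h2
    exact h2.1 (P.refl' a)
  ext a b
  exact ⟨key (fun f g => (h f g).2) a b, key (fun f g => (h f g).1) a b⟩

theorem inv_comp {R : Split X Y} {P : Split Y Z} {f : X → Prop} {h : Z → Prop} :
    Inv (comp R P) f h ↔ ∃ g, Inv R f g ∧ Inv P g h := by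
  constructor
  · intro H
    let L : X ⊕ (Y ⊕ Z) → Prop := fun w => ∃ a : X ⊕ Z, Sum.elim f h a ∧
      Relation.EqvGen (Link R P) (Sum.map id Sum.inr a) w
    have hL : ∀ b : X ⊕ Z, L (Sum.map id Sum.inr b) ↔ Sum.elim f h b := by
      intro b
      constructor
      · rintro ⟨a, ha, hab⟩
        exact (H a b hab).1 ha
      · intro hb
        exact ⟨b, hb, .refl _⟩
    have hlink : ∀ u v, Link R P u v → (L u ↔ L v) := by
      intro u v huv
      constructor
      · rintro ⟨a, ha, hau⟩
        exact ⟨a, ha, hau.trans _ _ _ (.rel _ _ huv)⟩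
      · rintro ⟨a, ha, hau⟩
        exact ⟨a, ha, hau.trans _ _ _ (.symm _ _ (.rel _ _ huv))⟩
    have hf : ∀ x, f x ↔ L (Sum.inl x) := fun x => (hL (Sum.inl x)).symm
    have hh : ∀ z, h z ↔ L (Sum.inr (Sum.inr z)) := fun z => (hL (Sum.inr z)).symm
    refine ⟨fun y => L (Sum.inr (Sum.inl y)), ?_, ?_⟩
    · intro a b hab
      have := hlink _ _ (Link.upper (P := P) hab)
      rcases a with a | a <;> rcases b with b | b <;> simpa [hf] using this
    · intro a b hab
      have := hlink _ _ (Link.lower (R := R) hab)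
      rcases a with a | a <;> rcases b with b | b <;> simpa [hh] using this
  · rintro ⟨g, hR, hP⟩ a b hab
    have key : ∀ u v, Relation.EqvGen (Link R P) u v →
        (Sum.elim f (Sum.elim g h) u ↔ Sum.elim f (Sum.elim g h) v) := by
      intro u v huv
      induction huv with
      | rel u v huv =>
        cases huv with
        | @upper a b hab =>
          have := hR a b hab
          rcases a with a | a <;> rcases b with b | b <;> simpa using this
        | lower hab => exact hP _ _ hab
      | refl => rfl
      | symm _ _ _ ih => exact ih.symm
      | trans _ _ _ _ _ ih₁ ih₂ => exact ih₁.trans ih₂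
    have := key _ _ hab
    rcases a with a | a <;> rcases b with b | b <;> simpa using this

theorem inv_ofEquiv {e : X ≃ Y} {f : X → Prop} {g : Y → Prop} :
    Inv (ofEquiv e) f g ↔ f = g ∘ e := by
  constructor
  · intro H
    funext x
    exact propext (H (Sum.inl x) (Sum.inr (e x)) rfl)
  · rintro rfl a b hab
    have h1 : ∀ w : X ⊕ Y, Sum.elim (g ∘ e) g w = g (Sum.elim e id w) := by
      rintro (w | w) <;> rfl
    rw [h1, h1, show Sum.elim e id a = Sum.elim e id b from hab]

theorem inv_tensor {R : Split X Y} {P : Split X' Y'} {f : X ⊕ X' → Prop} {g : Y ⊕ Y' → Prop} :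
    Inv (tensor R P) f g ↔
      Inv R (f ∘ Sum.inl) (g ∘ Sum.inl) ∧ Inv P (f ∘ Sum.inr) (g ∘ Sum.inr) := by
  constructor
  · intro H
    constructor
    · intro a b hab
      have := H ((Equiv.sumSumSumComm X X' Y Y').symm (Sum.inl a))
        ((Equiv.sumSumSumComm X X' Y Y').symm (Sum.inl b))
        (by
          change Sum.LiftRel R P _ _
          simp only [Equiv.apply_symm_apply]
          exact .inl hab)
      rcases a with a | a <;> rcases b with b | b <;> exact this
    · intro a b hab
      have := H ((Equiv.sumSumSumComm X X' Y Y').symm (Sum.inr a))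
        ((Equiv.sumSumSumComm X X' Y Y').symm (Sum.inr b))
        (by
          change Sum.LiftRel R P _ _
          simp only [Equiv.apply_symm_apply]
          exact .inr hab)
      rcases a with a | a <;> rcases b with b | b <;> exact this
  · rintro ⟨h1, h2⟩ a b hab
    change Sum.LiftRel R P _ _ at hab
    rcases a with (a | a) | (a | a) <;> rcases b with (b | b) | (b | b) <;>
      cases hab <;> first
        | exact h1 (Sum.inl _) (Sum.inl _) ‹_›
        | exact h1 (Sum.inl _) (Sum.inr _) ‹_›
        | exact h1 (Sum.inr _) (Sum.inl _) ‹_›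
        | exact h1 (Sum.inr _) (Sum.inr _) ‹_›
        | exact h2 (Sum.inl _) (Sum.inl _) ‹_›
        | exact h2 (Sum.inl _) (Sum.inr _) ‹_›
        | exact h2 (Sum.inr _) (Sum.inl _) ‹_›
        | exact h2 (Sum.inr _) (Sum.inr _) ‹_›

/-! ### Brauerian split equivalences -/

theorem Brauerian.comap {R : Setoid X} (hR : Brauerian R) (e : Y ≃ X) :
    Brauerian (R.comap e) := by
  intro a
  obtain ⟨b, ⟨hb, hab⟩, hu⟩ := hR (e a)
  refine ⟨e.symm b, ⟨fun h => hb (by rw [← h]; simp), ?_⟩, ?_⟩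
  · change R (e a) (e (e.symm b))
    simpa using hab
  · rintro y ⟨hy, hay⟩
    rw [← hu (e y) ⟨fun h => hy (e.injective h), hay⟩]
    simp

theorem Brauerian.sum {R : Setoid X} {P : Setoid Y} (hR : Brauerian R) (hP : Brauerian P) :
    Brauerian (sum R P) := by
  rintro (a | a)
  · obtain ⟨b, ⟨hb, hab⟩, hu⟩ := hR a
    refine ⟨Sum.inl b, ⟨fun h => hb (Sum.inl.inj h), .inl hab⟩, ?_⟩
    rintro y ⟨hy, hay⟩
    cases hay with
    | inl h => rw [hu _ ⟨fun h' => hy (by rw [h']), h⟩]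
  · obtain ⟨b, ⟨hb, hab⟩, hu⟩ := hP a
    refine ⟨Sum.inr b, ⟨fun h => hb (Sum.inr.inj h), .inr hab⟩, ?_⟩
    rintro y ⟨hy, hay⟩
    cases hay with
    | inr h => rw [hu _ ⟨fun h' => hy (by rw [h']), h⟩]

theorem Brauerian.tensor {R : Split X Y} {P : Split X' Y'} (hR : Brauerian R)
    (hP : Brauerian P) : Brauerian (tensor R P) := (hR.sum hP).comap _

theorem brauerian_ofEquiv (e : X ≃ Y) : Brauerian (ofEquiv e) := by
  rintro (a | a)
  · refine ⟨Sum.inr (e a), ⟨by simp, rfl⟩, ?_⟩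
    rintro (y | y) ⟨hy, hay⟩
    · exact absurd (congrArg Sum.inl (e.injective hay).symm) hy
    · exact congrArg Sum.inr (Eq.symm hay)
  · refine ⟨Sum.inl (e.symm a), ⟨by simp, (e.apply_symm_apply a).symm⟩, ?_⟩
    rintro (y | y) ⟨hy, hay⟩
    · exact congrArg Sum.inl ((Equiv.eq_symm_apply e).2 (Eq.symm hay))
    · exact absurd (congrArg Sum.inr (Eq.symm hay)) hy

/-- In a finite set with two involutions, a component that has a fixed point of one of them (and is
not a single point) has exactly two points that are fixed by one of the involutions. -/
theorem exists_unique_endpoint [Finite W] {s t : Equiv.Perm W} (hs : ∀ w, s (s w) = w)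
    (ht : ∀ w, t (t w) = w) {x : W} (hx : t x = x) (hx' : s x ≠ x) :
    ∃! y, y ≠ x ∧ (s y = y ∨ t y = y) ∧
      Relation.EqvGen (fun a b => s a = b ∨ t a = b) x y := by
  set p : Equiv.Perm W := s * t with hp
  have tp : ∀ j : ℤ, t ((p ^ j) x) = (p ^ (-j)) x := by
    have h1 : t * p * t⁻¹ = p⁻¹ := by
      ext w
      have hsi : s⁻¹ = s := by ext w; rw [Equiv.Perm.inv_eq_iff_eq]; exact (hs w).symm
      have hti : t⁻¹ = t := by ext w; rw [Equiv.Perm.inv_eq_iff_eq]; exact (ht w).symm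
      rw [hp, mul_inv_rev, hsi, hti]
      simp [ht]
    intro j
    have h2 : t * p ^ j * t⁻¹ = p ^ (-j) := by rw [← conj_zpow, h1, inv_zpow, zpow_neg]
    have h3 : t⁻¹ x = x := by rw [Equiv.Perm.inv_eq_iff_eq, hx]
    have h4 := congrArg (fun q : Equiv.Perm W => q x) h2
    simpa only [Equiv.Perm.mul_apply, h3] using h4
  have sp : ∀ j : ℤ, s ((p ^ j) x) = (p ^ (1 - j)) x := by
    intro j
    have h1 : s ((p ^ j) x) = p (t ((p ^ j) x)) := by
      rw [hp, Equiv.Perm.mul_apply, ht]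
    rw [h1, tp, sub_eq_add_neg, zpow_add, zpow_one, Equiv.Perm.mul_apply (f := p)]
  let E := Relation.EqvGen (fun a b => s a = b ∨ t a = b)
  have st_E : ∀ w, E w (p w) := fun w =>
    .trans _ (t w) _ (.rel _ _ (.inr rfl)) (.rel _ _ (.inl rfl))
  have E_pow : ∀ j : ℤ, E x ((p ^ j) x) := by
    intro j
    induction j using Int.induction_on with
    | zero => exact .refl _
    | succ i ih =>
      have := st_E ((p ^ (i : ℤ)) x)
      rw [← Equiv.Perm.mul_apply, ← zpow_one_add, add_comm] at this
      exact ih.trans _ _ _ this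
    | pred i ih =>
      have := st_E ((p ^ (-(i : ℤ) - 1)) x)
      rw [← Equiv.Perm.mul_apply, ← zpow_one_add] at this
      rw [show (1 : ℤ) + (-(i : ℤ) - 1) = -i by ring] at this
      exact ih.trans _ _ _ (.symm _ _ this)
  have pow_E : ∀ y, E x y → ∃ j : ℤ, y = (p ^ j) x := by
    have key : ∀ u v, E u v → ((∃ j : ℤ, u = (p ^ j) x) ↔ (∃ j : ℤ, v = (p ^ j) x)) := by
      intro u v huv
      induction huv with
      | rel u v h =>
        constructor
        · rintro ⟨j, rfl⟩
          rcases h with h | h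
          · exact ⟨1 - j, by rw [← sp, h]⟩
          · exact ⟨-j, by rw [← tp, h]⟩
        · rintro ⟨j, rfl⟩
          rcases h with h | h
          · exact ⟨1 - j, by rw [← sp, ← h, hs]⟩
          · exact ⟨-j, by rw [← tp, ← h, ht]⟩
      | refl => rfl
      | symm _ _ _ ih => exact ih.symm
      | trans _ _ _ _ _ ih₁ ih₂ => exact ih₁.trans ih₂
    intro y hy
    exact (key x y hy).1 ⟨0, by simp⟩
  set N : ℕ := Function.minimalPeriod p x with hN
  have per : ∀ j : ℤ, (p ^ j) x = x ↔ (N : ℤ) ∣ j := fun j =>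
    MulAction.zpow_smul_eq_iff_minimalPeriod_dvd (a := p) (b := x) (n := j)
  have per' : ∀ i j : ℤ, (p ^ i) x = (p ^ j) x ↔ (N : ℤ) ∣ i - j := by
    intro i j
    rw [← per, sub_eq_neg_add, zpow_add, Equiv.Perm.mul_apply, zpow_neg,
      Equiv.Perm.inv_eq_iff_eq]
  have hN0 : 0 < N := by
    have : ∃ k : ℕ, 0 < k ∧ p ^ k = 1 := isOfFinOrder_iff_pow_eq_one.1 (isOfFinOrder_of_finite p)
    obtain ⟨k, hk, hpk⟩ := this
    have h1 : (N : ℤ) ∣ (k : ℤ) := (per k).1 (by rw [zpow_natCast, hpk]; rfl)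
    exact Nat.pos_of_dvd_of_pos (by exact_mod_cast h1) hk
  have hN1 : N ≠ 1 := by
    intro h
    apply hx'
    have h1 := sp 0
    rw [zpow_zero, Equiv.Perm.one_apply] at h1
    rw [h1, per, h]
    simp
  have fixs : ∀ j : ℤ, s ((p ^ j) x) = (p ^ j) x ↔ (N : ℤ) ∣ 1 - 2 * j := by
    intro j
    rw [sp, per', show (1 - j - j : ℤ) = 1 - 2 * j by ring]
  have fixt : ∀ j : ℤ, t ((p ^ j) x) = (p ^ j) x ↔ (N : ℤ) ∣ 2 * j := by
    intro j
    rw [tp, per', show (-j - j : ℤ) = -(2 * j) by ring, dvd_neg]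
  rcases Nat.even_or_odd' N with ⟨k, hk | hk⟩
  · refine ⟨(p ^ (k : ℤ)) x, ⟨?_, .inr ?_, E_pow _⟩, ?_⟩
    · rw [Ne, per]
      intro h
      have := Int.le_of_dvd (by omega) h
      omega
    · rw [fixt]
      exact ⟨1, by rw [hk]; push_cast; ring⟩
    · rintro y ⟨hy, hy', hE⟩
      obtain ⟨j, rfl⟩ := pow_E y hE
      rw [Ne, per] at hy
      rw [fixs, fixt] at hy'
      rw [per']
      rcases hy' with ⟨q, hq⟩ | ⟨q, hq⟩
      · exfalso
        have h1 : (2 : ℤ) ∣ 1 - 2 * j := ⟨k * q, by rw [hq, hk]; push_cast; ring⟩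
        omega
      · have hj : j = k * q := by
          rw [hk] at hq
          push_cast at hq
          linarith
        rcases Int.even_or_odd' q with ⟨m, hm | hm⟩
        · exact absurd ⟨m, by rw [hj, hm, hk]; push_cast; ring⟩ hy
        · exact ⟨m, by rw [hj, hm, hk]; push_cast; ring⟩
  · refine ⟨(p ^ ((k : ℤ) + 1)) x, ⟨?_, .inl ?_, E_pow _⟩, ?_⟩
    · rw [Ne, per]
      intro h
      have := Int.le_of_dvd (by omega) h
      omega
    · rw [fixs]
      exact ⟨-1, by rw [hk]; push_cast; ring⟩
    · rintro y ⟨hy, hy', hE⟩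
      obtain ⟨j, rfl⟩ := pow_E y hE
      rw [Ne, per] at hy
      rw [fixs, fixt] at hy'
      rw [per']
      have hcop : IsCoprime (N : ℤ) 2 := ⟨1, -k, by rw [hk]; push_cast; ring⟩
      rcases hy' with h | h
      · refine hcop.dvd_of_dvd_mul_left ?_
        have h1 : (2 * (j - (k + 1)) : ℤ) = -(1 - 2 * j) - N := by rw [hk]; push_cast; ring
        rw [h1]
        exact dvd_sub ((dvd_neg (α := ℤ)).2 h) dvd_rfl
      · exact absurd (hcop.dvd_of_dvd_mul_left h) hy

/-- A Brauerian equivalence relation is given by an involution without fixed points. -/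
theorem Brauerian.exists_perm {R : Setoid X} (hR : Brauerian R) :
    ∃ s : Equiv.Perm X, (∀ a, s (s a) = a) ∧ (∀ a, s a ≠ a) ∧
      ∀ a b, R a b ↔ b = a ∨ b = s a := by
  choose s hs hu using hR
  have hss : Function.Involutive s := fun a =>
    (hu (s a) a ⟨(hs a).1.symm, R.symm' (hs a).2⟩).symm
  refine ⟨hss.toPerm, hss, fun a => (hs a).1, fun a b => ⟨fun h => ?_, ?_⟩⟩
  · by_cases hb : b = a
    · exact .inl hb
    · exact .inr (hu a b ⟨hb, h⟩)
  · rintro (rfl | rfl)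
    · exact R.refl' _
    · exact (hs a).2

theorem Brauerian.comp [Finite X] [Finite Y] [Finite Z] {R : Split X Y} {P : Split Y Z}
    (hR : Brauerian R) (hP : Brauerian P) : Brauerian (comp R P) := by
  obtain ⟨s, hs, hs', hRs⟩ := hR.exists_perm
  obtain ⟨t, ht, ht', hPt⟩ := hP.exists_perm
  let S : Equiv.Perm (X ⊕ (Y ⊕ Z)) :=
    (Equiv.sumAssoc X Y Z).permCongr (Equiv.sumCongr s (Equiv.refl Z))
  let T : Equiv.Perm (X ⊕ (Y ⊕ Z)) := Equiv.sumCongr (Equiv.refl X) t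
  have hSl : ∀ a : X ⊕ Y, S (Sum.map id Sum.inl a) = Sum.map id Sum.inl (s a) := by
    have h1 : ∀ a : X ⊕ Y, (Sum.map id Sum.inl a : X ⊕ (Y ⊕ Z)) =
      Equiv.sumAssoc X Y Z (Sum.inl a) := by rintro (a | a) <;> rfl
    intro a
    rw [h1, h1]
    simp [S, Equiv.permCongr_apply]
  have hSr : ∀ z : Z, S (Sum.inr (Sum.inr z)) = Sum.inr (Sum.inr z) := fun z => rfl
  have hTr : ∀ a : Y ⊕ Z, T (Sum.inr a) = Sum.inr (t a) := fun a => rfl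
  have hTl : ∀ x : X, T (Sum.inl x) = Sum.inl x := fun x => rfl
  have hcover : ∀ w : X ⊕ (Y ⊕ Z), (∃ a : X ⊕ Y, w = Sum.map id Sum.inl a) ∨
      ∃ z : Z, w = Sum.inr (Sum.inr z) := by
    rintro (x | y | z)
    · exact .inl ⟨Sum.inl x, rfl⟩
    · exact .inl ⟨Sum.inr y, rfl⟩
    · exact .inr ⟨z, rfl⟩
  have hinj : Function.Injective (Sum.map id Sum.inl : X ⊕ Y → X ⊕ (Y ⊕ Z)) :=
    Sum.map_injective.2 ⟨Function.injective_id, Sum.inl_injective⟩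
  have hS : ∀ w, S (S w) = w := by
    intro w
    rcases hcover w with ⟨a, rfl⟩ | ⟨z, rfl⟩
    · rw [hSl, hSl, hs]
    · rfl
  have hT : ∀ w, T (T w) = w := by
    rintro (x | a)
    · rfl
    · rw [hTr, hTr, ht]
  have hSfix : ∀ w, S w = w ↔ ∃ z : Z, w = Sum.inr (Sum.inr z) := by
    intro w
    constructor
    · intro h
      rcases hcover w with ⟨a, rfl⟩ | h'
      · rw [hSl] at h
        exact absurd (hinj h) (hs' a)
      · exact h'
    · rintro ⟨z, rfl⟩
      exact hSr z
  have hTfix : ∀ w, T w = w ↔ ∃ x : X, w = Sum.inl x := by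
    rintro (x | a)
    · exact ⟨fun _ => ⟨x, rfl⟩, fun _ => rfl⟩
    · constructor
      · intro h
        rw [hTr] at h
        exact absurd (Sum.inr.inj h) (ht' a)
      · rintro ⟨x, h⟩
        cases h
  have hE : ∀ u v, Relation.EqvGen (Link R P) u v ↔
      Relation.EqvGen (fun a b => S a = b ∨ T a = b) u v := by
    intro u v
    constructor
    · intro h
      induction h with
      | rel u v h =>
        cases h with
        | @upper a b h =>
          rcases (hRs a b).1 h with rfl | rfl
          · exact .refl _
          · exact .rel _ _ (.inl (hSl a))
        | @lower a b h =>
          rcases (hPt a b).1 h with rfl | rfl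
          · exact .refl _
          · exact .rel _ _ (.inr (hTr a))
      | refl => exact .refl _
      | symm _ _ _ ih => exact .symm _ _ ih
      | trans _ _ _ _ _ ih₁ ih₂ => exact .trans _ _ _ ih₁ ih₂
    · intro h
      induction h with
      | rel u v h =>
        rcases h with rfl | rfl
        · rcases hcover u with ⟨a, rfl⟩ | ⟨z, rfl⟩
          · rw [hSl]
            exact .rel _ _ (.upper ((hRs _ _).2 (.inr rfl)))
          · exact .refl _
        · rcases u with x | a
          · exact .refl _
          · exact .rel _ _ (.lower ((hPt _ _).2 (.inr rfl)))
      | refl => exact .refl _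
      | symm _ _ _ ih => exact .symm _ _ ih
      | trans _ _ _ _ _ ih₁ ih₂ => exact .trans _ _ _ ih₁ ih₂
  have houter : Function.Injective (Sum.map id Sum.inr : X ⊕ Z → X ⊕ (Y ⊕ Z)) :=
    Sum.map_injective.2 ⟨Function.injective_id, Sum.inr_injective⟩
  have hend : ∀ w, (S w = w ∨ T w = w) ↔ ∃ b : X ⊕ Z, w = Sum.map id Sum.inr b := by
    intro w
    rw [hSfix, hTfix]
    constructor
    · rintro (⟨z, rfl⟩ | ⟨x, rfl⟩)
      · exact ⟨Sum.inr z, rfl⟩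
      · exact ⟨Sum.inl x, rfl⟩
    · rintro ⟨x | z, rfl⟩
      · exact .inr ⟨x, rfl⟩
      · exact .inl ⟨z, rfl⟩
  intro a
  have main : ∃! y, y ≠ Sum.map id Sum.inr a ∧ (S y = y ∨ T y = y) ∧
      Relation.EqvGen (fun a b => S a = b ∨ T a = b) (Sum.map id Sum.inr a) y := by
    rcases a with x | z
    · refine exists_unique_endpoint hS hT (hTl x) ?_
      rw [Ne, hSfix]
      rintro ⟨z, h⟩
      cases h
    · have := exists_unique_endpoint (W := X ⊕ (Y ⊕ Z)) hT hS (hSr z) (by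
        rw [Ne, hTfix]
        rintro ⟨x, h⟩
        cases h)
      obtain ⟨y, ⟨h1, h2, h3⟩, hu⟩ := this
      have hsw : (fun a b => S a = b ∨ T a = b) = (fun a b => T a = b ∨ S a = b) := by
        funext a b
        exact propext or_comm
      rw [hsw]
      exact ⟨y, ⟨h1, h2.symm, h3⟩, fun y' h => hu y' ⟨h.1, h.2.1.symm, h.2.2⟩⟩
  obtain ⟨y, ⟨hy, hy', hay⟩, hu⟩ := main
  obtain ⟨b, rfl⟩ := (hend y).1 hy'
  refine ⟨b, ⟨fun h => hy (by rw [h]), (hE _ _).2 hay⟩, ?_⟩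
  rintro b' ⟨hb', hab'⟩
  exact houter (hu _ ⟨fun h => hb' (houter h), (hend _).2 ⟨b', rfl⟩, (hE _ _).1 hab'⟩)

end Split

/-! ## The category `Br` -/

/-- An arrow of `Br` from `m` to `n`: a Brauerian split equivalence between the ordinals `m`
and `n`. -/
@[ext]
structure BrHom (m n : ℕ) where
  rel : Split (Fin m) (Fin n)
  brauerian : Split.Brauerian rel

namespace BrHom

/-- The arrow of `Br` whose lines join `i` to `e i`. -/
def ofEquiv {m n : ℕ} (e : Fin m ≃ Fin n) : BrHom m n :=
  ⟨Split.ofEquiv e, Split.brauerian_ofEquiv e⟩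

/-- Vertical composition of diagrams, `R` above `P`. -/
def comp {m n k : ℕ} (R : BrHom m n) (P : BrHom n k) : BrHom m k :=
  ⟨Split.comp R.rel P.rel, R.brauerian.comp P.brauerian⟩

/-- Horizontal composition of diagrams, `R` to the left of `P`. -/
def tensor {m n m' n' : ℕ} (R : BrHom m n) (P : BrHom m' n') : BrHom (m + m') (n + n') :=
  ⟨(Split.tensor R.rel P.rel).comap (Equiv.sumCongr finSumFinEquiv.symm finSumFinEquiv.symm),
    (R.brauerian.tensor P.brauerian).comap _⟩

/-- A single cap. -/
def cap : BrHom 0 2 := ⟨⊤, by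
  have h : ∀ a : Fin 0 ⊕ Fin 2, ∃ b, (b ≠ a ∧ True) ∧ ∀ b', b' ≠ a ∧ True → b' = b := by decide
  exact h⟩

/-- A cup that joins the two middle points of the source, and two lines that join the outer points
of the source to those of the target. -/
def cup : BrHom (2 + 2) 2 :=
  ⟨Setoid.ker (Sum.elim (![0, 1, 1, 2] : Fin (2 + 2) → Fin 3) (![0, 2] : Fin 2 → Fin 3)), by
    let l := Sum.elim (![0, 1, 1, 2] : Fin (2 + 2) → Fin 3) (![0, 2] : Fin 2 → Fin 3)
    have h : ∀ a : Fin (2 + 2) ⊕ Fin 2, ∃ b, (b ≠ a ∧ l a = l b) ∧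
      ∀ b', b' ≠ a ∧ l a = l b' → b' = b := by decide
    exact h⟩

/-- Assignments that respect an arrow of `Br`. -/
def Inv {m n : ℕ} (R : BrHom m n) (f : Fin m → Prop) (g : Fin n → Prop) : Prop :=
  Split.Inv R.rel f g

theorem ext_inv {m n : ℕ} {R P : BrHom m n} (h : ∀ f g, Inv R f g ↔ Inv P f g) : R = P :=
  BrHom.ext (Split.ext_inv h)

theorem inv_comp {m n k : ℕ} {R : BrHom m n} {P : BrHom n k} {f : Fin m → Prop}
    {h : Fin k → Prop} : Inv (comp R P) f h ↔ ∃ g, Inv R f g ∧ Inv P g h :=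
  Split.inv_comp

theorem inv_ofEquiv {m n : ℕ} {e : Fin m ≃ Fin n} {f : Fin m → Prop} {g : Fin n → Prop} :
    Inv (ofEquiv e) f g ↔ f = g ∘ e :=
  Split.inv_ofEquiv

theorem inv_tensor {m n m' n' : ℕ} {R : BrHom m n} {P : BrHom m' n'} {f : Fin (m + m') → Prop}
    {g : Fin (n + n') → Prop} :
    Inv (tensor R P) f g ↔
      Inv R (fun i => f (Fin.castAdd m' i)) (fun i => g (Fin.castAdd n' i)) ∧
        Inv P (fun i => f (Fin.natAdd m i)) (fun i => g (Fin.natAdd n i)) := by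
  have h1 : Inv (tensor R P) f g ↔
      Split.Inv (Split.tensor R.rel P.rel) (f ∘ finSumFinEquiv) (g ∘ finSumFinEquiv) := by
    have h2 : ∀ w : (Fin m ⊕ Fin m') ⊕ (Fin n ⊕ Fin n'),
        Sum.elim (f ∘ finSumFinEquiv) (g ∘ finSumFinEquiv) w =
        Sum.elim f g (Equiv.sumCongr finSumFinEquiv finSumFinEquiv w) := by
      rintro (w | w) <;> rfl
    constructor
    · intro H a b hab
      rw [h2, h2]
      refine H _ _ ?_
      change Split.tensor R.rel P.rel ((Equiv.sumCongr finSumFinEquiv finSumFinEquiv).symm _)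
        ((Equiv.sumCongr finSumFinEquiv finSumFinEquiv).symm _)
      simpa only [Equiv.symm_apply_apply] using hab
    · intro H a b hab
      have := H ((Equiv.sumCongr finSumFinEquiv finSumFinEquiv).symm a)
        ((Equiv.sumCongr finSumFinEquiv finSumFinEquiv).symm b) hab
      rw [h2, h2] at this
      simpa only [Equiv.apply_symm_apply] using this
  rw [h1, Split.inv_tensor]
  rfl

theorem inv_cap {f : Fin 0 → Prop} {g : Fin 2 → Prop} : Inv cap f g ↔ g 0 = g 1 := by
  constructor
  · intro H
    exact propext (H (Sum.inr 0) (Sum.inr 1) trivial)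
  · intro h a b _
    rcases a with a | a
    · exact a.elim0
    rcases b with b | b
    · exact b.elim0
    fin_cases a <;> fin_cases b <;> simp [h]

theorem inv_cup {f : Fin (2 + 2) → Prop} {g : Fin 2 → Prop} :
    Inv cup f g ↔ f 0 = g 0 ∧ f 1 = f 2 ∧ f 3 = g 1 := by
  constructor
  · intro H
    exact ⟨propext (H (Sum.inl 0) (Sum.inr 0) rfl), propext (H (Sum.inl 1) (Sum.inl 2) rfl),
      propext (H (Sum.inl 3) (Sum.inr 1) rfl)⟩
  · rintro ⟨h1, h2, h3⟩
    have key : ∀ w : Fin (2 + 2) ⊕ Fin 2, Sum.elim f g w = (![g 0, f 2, g 1] : Fin 3 → Prop)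
        (Sum.elim (![0, 1, 1, 2] : Fin (2 + 2) → Fin 3) (![0, 2] : Fin 2 → Fin 3) w) := by
      rintro (w | w)
      · fin_cases w
        · exact h1
        · exact h2
        · rfl
        · exact h3
      · fin_cases w <;> rfl
    intro a b hab
    rw [key, key]
    exact iff_of_eq (congrArg _ hab)

theorem id_comp {m n : ℕ} (R : BrHom m n) : comp (ofEquiv (Equiv.refl (Fin m))) R = R :=
  ext_inv fun f g => by simp [inv_comp, inv_ofEquiv]

theorem comp_id {m n : ℕ} (R : BrHom m n) : comp R (ofEquiv (Equiv.refl (Fin n))) = R :=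
  ext_inv fun f g => by simp [inv_comp, inv_ofEquiv]

theorem comp_assoc {m n k l : ℕ} (R : BrHom m n) (P : BrHom n k) (Q : BrHom k l) :
    comp (comp R P) Q = comp R (comp P Q) :=
  ext_inv fun f g => by
    simp only [inv_comp]
    constructor
    · rintro ⟨a, ⟨b, h1, h2⟩, h3⟩
      exact ⟨b, h1, a, h2, h3⟩
    · rintro ⟨b, h1, a, h2, h3⟩
      exact ⟨a, ⟨b, h1, h2⟩, h3⟩

end BrHom

/-- The objects of `Br` are the finite ordinals. -/
def Br : Type := ℕ

/-- The category of Brauerian split equivalences of finite ordinals. -/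
instance Br.category : CategoryTheory.Category Br where
  Hom m n := BrHom m n
  id m := BrHom.ofEquiv (Equiv.refl (Fin m))
  comp R P := BrHom.comp R P
  id_comp R := BrHom.id_comp R
  comp_id R := BrHom.comp_id R
  assoc R P Q := BrHom.comp_assoc R P Q

/-! ## The functor `G` -/

/-- The diagram of an arrow term. -/
def ArrowTerm.diagram {V : Type*} : ∀ {A B : Formula V}, ArrowTerm A B → BrHom A.size B.size
  | _, _, one A => BrHom.ofEquiv (Equiv.refl (Fin A.size))
  | _, _, bR A B C => BrHom.ofEquiv (finCongr (Nat.add_assoc A.size B.size C.size).symm)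
  | _, _, bL A B C => BrHom.ofEquiv (finCongr (Nat.add_assoc A.size B.size C.size))
  | _, _, deltaR A => BrHom.ofEquiv (finCongr (Nat.add_zero A.size))
  | _, _, deltaL A => BrHom.ofEquiv (finCongr (Nat.add_zero A.size).symm)
  | _, _, sigmaR A => BrHom.ofEquiv (finCongr (Nat.zero_add A.size))
  | _, _, sigmaL A => BrHom.ofEquiv (finCongr (Nat.zero_add A.size).symm)
  | _, _, r _ => BrHom.cap
  | _, _, t _ _ _ => BrHom.cup
  | _, _, c A B => BrHom.ofEquiv (finAddFlip (m := A.size) (n := B.size))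
  | _, _, and f g => BrHom.tensor f.diagram g.diagram
  | _, _, comp g f => BrHom.comp f.diagram g.diagram


namespace BrHom

theorem inv_ofEquiv_comp {m n k : ℕ} {e : Fin m ≃ Fin n} {P : BrHom n k} {f : Fin m → Prop}
    {h : Fin k → Prop} : Inv (comp (ofEquiv e) P) f h ↔ Inv P (fun i => f (e.symm i)) h := by
  rw [inv_comp]
  constructor
  · rintro ⟨g, hg, hP⟩
    rw [inv_ofEquiv] at hg
    subst hg
    simpa using hP
  · intro hP
    exact ⟨_, inv_ofEquiv.2 (by funext i; simp), hP⟩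

theorem inv_comp_ofEquiv {m n k : ℕ} {R : BrHom m n} {e : Fin n ≃ Fin k} {f : Fin m → Prop}
    {h : Fin k → Prop} : Inv (comp R (ofEquiv e)) f h ↔ Inv R f (fun i => h (e i)) := by
  rw [inv_comp]
  constructor
  · rintro ⟨g, hg, hP⟩
    rw [inv_ofEquiv] at hP
    subst hP
    exact hg
  · intro hP
    exact ⟨_, hP, inv_ofEquiv.2 rfl⟩

theorem ofEquiv_comp_ofEquiv {m n k : ℕ} (e : Fin m ≃ Fin n) (e' : Fin n ≃ Fin k) :
    comp (ofEquiv e) (ofEquiv e') = ofEquiv (e.trans e') :=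
  ext_inv fun f g => by
    rw [inv_comp_ofEquiv, inv_ofEquiv, inv_ofEquiv]
    rfl

theorem ofEquiv_tensor_ofEquiv {m n m' n' : ℕ} (e : Fin m ≃ Fin n) (e' : Fin m' ≃ Fin n') :
    tensor (ofEquiv e) (ofEquiv e') = ofEquiv
      ((finSumFinEquiv.symm.trans (Equiv.sumCongr e e')).trans finSumFinEquiv) :=
  ext_inv fun f g => by
    rw [inv_tensor, inv_ofEquiv, inv_ofEquiv, inv_ofEquiv]
    constructor
    · rintro ⟨h1, h2⟩
      funext i
      refine Fin.addCases (fun i => ?_) (fun i => ?_) i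
      · simpa using congrFun h1 i
      · simpa using congrFun h2 i
    · rintro rfl
      constructor <;> funext i <;> simp

theorem tensor_comp {m n k m' n' k' : ℕ} (R : BrHom m n) (P : BrHom n k) (R' : BrHom m' n')
    (P' : BrHom n' k') :
    tensor (comp R P) (comp R' P') = comp (tensor R R') (tensor P P') :=
  ext_inv fun f h => by
    simp only [inv_tensor, inv_comp]
    constructor
    · rintro ⟨⟨g, h1, h2⟩, ⟨g', h1', h2'⟩⟩
      refine ⟨Fin.addCases g g', ?_⟩
      simpa using ⟨⟨h1, h1'⟩, h2, h2'⟩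
    · rintro ⟨g, ⟨h1, h1'⟩, h2, h2'⟩
      exact ⟨⟨_, h1, h2⟩, ⟨_, h1', h2'⟩⟩

theorem cast_comp_cast {m n k : ℕ} (h : m = n) (h' : n = k) :
    comp (ofEquiv (finCongr h)) (ofEquiv (finCongr h')) = ofEquiv (finCongr (h.trans h')) := by
  rw [ofEquiv_comp_ofEquiv]
  rfl

theorem cast_tensor_cast {m n m' n' : ℕ} (h : m = n) (h' : m' = n') :
    tensor (ofEquiv (finCongr h)) (ofEquiv (finCongr h')) =
      ofEquiv (finCongr (by rw [h, h'])) := by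
  subst h h'
  rw [ofEquiv_tensor_ofEquiv]
  congr 1
  ext i
  refine Fin.addCases (fun i => ?_) (fun i => ?_) i <;> simp

theorem refl_eq_cast (m : ℕ) : ofEquiv (Equiv.refl (Fin m)) = ofEquiv (finCongr rfl) := rfl

theorem pentagon (a b c d : ℕ) :
    comp (ofEquiv (finCongr (Nat.add_assoc a b (c + d)).symm))
      (ofEquiv (finCongr (Nat.add_assoc (a + b) c d).symm)) =
    comp (comp (tensor (ofEquiv (Equiv.refl (Fin a)))
      (ofEquiv (finCongr (Nat.add_assoc b c d).symm)))
      (ofEquiv (finCongr (Nat.add_assoc a (b + c) d).symm)))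
      (tensor (ofEquiv (finCongr (Nat.add_assoc a b c).symm)) (ofEquiv (Equiv.refl (Fin d)))) := by
  simp only [refl_eq_cast, cast_tensor_cast, cast_comp_cast]

theorem triangle (a c : ℕ) :
    ofEquiv (finCongr (Nat.add_assoc a 0 c).symm) =
    comp (tensor (ofEquiv (Equiv.refl (Fin a))) (ofEquiv (finCongr (Nat.zero_add c))))
      (tensor (ofEquiv (finCongr (Nat.add_zero a).symm)) (ofEquiv (Equiv.refl (Fin c)))) := by
  simp only [refl_eq_cast, cast_tensor_cast, cast_comp_cast]

theorem assoc_nat {a b c d e f : ℕ} (R : BrHom a d) (P : BrHom b e) (Q : BrHom c f) :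
    comp (ofEquiv (finCongr (Nat.add_assoc a b c).symm)) (tensor (tensor R P) Q) =
      comp (tensor R (tensor P Q)) (ofEquiv (finCongr (Nat.add_assoc d e f).symm)) :=
  ext_inv fun u v => by
    rw [inv_ofEquiv_comp, inv_comp_ofEquiv]
    simp only [inv_tensor, and_assoc]
    have e1 : ∀ {a b c : ℕ} (i : Fin b),
        (finCongr (Nat.add_assoc a b c).symm) (Fin.natAdd a (Fin.castAdd c i)) =
          Fin.castAdd c (Fin.natAdd a i) := fun i => Fin.ext rfl
    have e2 : ∀ {a b c : ℕ} (i : Fin c),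
        (finCongr (Nat.add_assoc a b c).symm) (Fin.natAdd a (Fin.natAdd b i)) =
          Fin.natAdd (a + b) i := fun i => Fin.ext (by simp [Nat.add_assoc])
    have e3 : ∀ {a b c : ℕ} (i : Fin c),
        (finCongr (Nat.add_assoc a b c).symm).symm (Fin.natAdd (a + b) i) =
          Fin.natAdd a (Fin.natAdd b i) := fun i => Fin.ext (by simp [Nat.add_assoc])
    simp only [e2, e3]
    rfl

theorem add_zero_nat {a d : ℕ} (R : BrHom a d) :
    comp (ofEquiv (finCongr (Nat.add_zero a))) R =
      comp (tensor R (ofEquiv (Equiv.refl (Fin 0)))) (ofEquiv (finCongr (Nat.add_zero d))) :=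
  ext_inv fun u v => by
    rw [inv_ofEquiv_comp, inv_comp_ofEquiv, inv_tensor, inv_ofEquiv]
    exact ⟨fun h => ⟨h, Subsingleton.elim _ _⟩, fun h => h.1⟩

theorem zero_add_nat {a d : ℕ} (R : BrHom a d) :
    comp (ofEquiv (finCongr (Nat.zero_add a))) R =
      comp (tensor (ofEquiv (Equiv.refl (Fin 0))) R) (ofEquiv (finCongr (Nat.zero_add d))) :=
  ext_inv fun u v => by
    rw [inv_ofEquiv_comp, inv_comp_ofEquiv, inv_tensor, inv_ofEquiv]
    have e1 : ∀ {a : ℕ} (i : Fin a), (finCongr (Nat.zero_add a)).symm i = Fin.natAdd 0 i :=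
      fun i => Fin.ext (by simp)
    have e2 : ∀ {a : ℕ} (i : Fin a), (finCongr (Nat.zero_add a)) (Fin.natAdd 0 i) = i :=
      fun i => Fin.ext (by simp)
    simp only [e1, e2]
    exact ⟨fun h => ⟨Subsingleton.elim _ _, h⟩, fun h => h.2⟩

theorem flip_nat {a b d e : ℕ} (R : BrHom a d) (P : BrHom b e) :
    comp (ofEquiv (finAddFlip (m := a) (n := b))) (tensor P R) =
      comp (tensor R P) (ofEquiv (finAddFlip (m := d) (n := e))) :=
  ext_inv fun u v => by
    rw [inv_ofEquiv_comp, inv_comp_ofEquiv, inv_tensor, inv_tensor, and_comm]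
    have e1 : ∀ {a b : ℕ}, (finAddFlip (m := a) (n := b)).symm = finAddFlip (m := b) (n := a) :=
      rfl
    simp [e1]

theorem flip_flip (a b : ℕ) :
    comp (ofEquiv (finAddFlip (m := a) (n := b))) (ofEquiv (finAddFlip (m := b) (n := a))) =
      ofEquiv (Equiv.refl _) := by
  rw [ofEquiv_comp_ofEquiv]
  congr 1
  exact Equiv.self_trans_symm (finAddFlip (m := a) (n := b))

theorem hexagon (a b c : ℕ) :
    comp (comp (comp (comp (ofEquiv (finCongr (Nat.add_assoc a b c).symm))
      (tensor (ofEquiv (finAddFlip (m := a) (n := b))) (ofEquiv (Equiv.refl (Fin c)))))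
      (ofEquiv (finCongr (Nat.add_assoc b a c))))
      (tensor (ofEquiv (Equiv.refl (Fin b))) (ofEquiv (finAddFlip (m := a) (n := c)))))
      (ofEquiv (finCongr (Nat.add_assoc b c a).symm)) =
    ofEquiv (finAddFlip (m := a) (n := b + c)) := by
  simp only [ofEquiv_tensor_ofEquiv, ofEquiv_comp_ofEquiv]
  congr 1
  ext i
  refine Fin.addCases (fun i => ?_) (fun i => ?_) i
  · have e1 : finCongr (Nat.add_assoc a b c).symm (Fin.castAdd (b + c) i) =
        Fin.castAdd c (Fin.castAdd b i) := Fin.ext rfl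
    have e2 : finCongr (Nat.add_assoc b a c) (Fin.castAdd c (Fin.natAdd b i)) =
        Fin.natAdd b (Fin.castAdd c i) := Fin.ext rfl
    simp only [Equiv.trans_apply, e1]
    simp [-finCongr_apply, e2]
    simp [Nat.add_assoc]
  · refine Fin.addCases (fun i => ?_) (fun i => ?_) i
    · have e1 : finCongr (Nat.add_assoc a b c).symm (Fin.natAdd a (Fin.castAdd c i)) =
        Fin.castAdd c (Fin.natAdd a i) := Fin.ext rfl
      have e2 : finCongr (Nat.add_assoc b a c) (Fin.castAdd c (Fin.castAdd a i)) =
        Fin.castAdd (a + c) i := Fin.ext rfl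
      simp only [Equiv.trans_apply, e1]
      simp [-finCongr_apply, e2]
    · have e1 : finCongr (Nat.add_assoc a b c).symm (Fin.natAdd a (Fin.natAdd b i)) =
        Fin.natAdd (a + b) i := Fin.ext (by simp [Nat.add_assoc])
      have e2 : finCongr (Nat.add_assoc b a c) (Fin.natAdd (b + a) i) =
        Fin.natAdd b (Fin.natAdd a i) := Fin.ext (by simp [Nat.add_assoc])
      simp only [Equiv.trans_apply, e1]
      simp [-finCongr_apply, e2]

theorem cup_cap_right :
    comp (tensor (ofEquiv (Equiv.refl (Fin 2))) cap) cup =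
      ofEquiv (finCongr (Nat.add_zero 2)) :=
  ext_inv fun f g => by
    simp only [inv_comp, inv_tensor, inv_ofEquiv, inv_cap, inv_cup]
    constructor
    · rintro ⟨h, ⟨h1, h2⟩, h3, h4, h5⟩
      funext i
      have h10 := congrFun h1 0
      have h11 := congrFun h1 1
      fin_cases i
      · exact h10.trans h3
      · exact h11.trans (h4.trans (h2.trans h5))
    · rintro rfl
      refine ⟨![g 0, g 1, g 1, g 1], ⟨?_, rfl⟩, rfl, rfl, rfl⟩
      funext i
      fin_cases i <;> rfl

theorem cup_cap_left :
    comp (tensor cap (ofEquiv (Equiv.refl (Fin 2)))) cup =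
      ofEquiv (finCongr (Nat.zero_add 2)) :=
  ext_inv fun f g => by
    simp only [inv_comp, inv_tensor, inv_ofEquiv, inv_cap, inv_cup]
    constructor
    · rintro ⟨h, ⟨h1, h2⟩, h3, h4, h5⟩
      funext i
      have h10 := congrFun h2 0
      have h11 := congrFun h2 1
      fin_cases i
      · exact h10.trans (h4.symm.trans (h1.symm.trans h3))
      · exact h11.trans h5
    · rintro rfl
      refine ⟨![g 0, g 0, g 0, g 1], ⟨rfl, ?_⟩, rfl, rfl, rfl⟩
      funext i
      fin_cases i <;> rfl

theorem cup_assoc :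
    comp (tensor (ofEquiv (Equiv.refl (Fin 2))) cup) cup =
      comp (comp (ofEquiv (finCongr (Nat.add_assoc 2 2 2).symm))
        (tensor cup (ofEquiv (Equiv.refl (Fin 2))))) cup :=
  ext_inv fun f g => by
    rw [comp_assoc, inv_ofEquiv_comp]
    simp only [inv_comp, inv_tensor, inv_ofEquiv, inv_cup]
    constructor
    · rintro ⟨h, ⟨h1, h2, h3, h4⟩, h5, h6, h7⟩
      have h10 := congrFun h1 0
      have h11 := congrFun h1 1
      refine ⟨![f 0, f 3, f 4, f 5], ⟨⟨rfl, ?_, rfl⟩, ?_⟩, ?_, h3, ?_⟩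
      · exact h11.trans (h6.trans h2.symm)
      · funext i
        fin_cases i <;> rfl
      · exact h10.trans h5
      · exact h4.trans h7
    · rintro ⟨h, ⟨⟨h1, h2, h3⟩, h4⟩, h5, h6, h7⟩
      have h10 := congrFun h4 0
      have h11 := congrFun h4 1
      refine ⟨![f 0, f 1, f 2, f 5], ⟨?_, rfl, ?_, rfl⟩, ?_, h2, ?_⟩
      · funext i
        fin_cases i <;> rfl
      · exact h3.trans (h6.trans h10.symm)
      · exact h1.trans h5
      · exact h11.trans h7

end BrHom

/-- Equal arrow terms have the same diagram. -/
theorem ArrowTerm.Equal.diagram_eq {V : Type*} {A B : Formula V} {f g : ArrowTerm A B}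
    (h : ArrowTerm.Equal f g) : f.diagram = g.diagram := by
  induction h with
  | refl => rfl
  | symm _ ih => exact ih.symm
  | trans _ _ ih₁ ih₂ => exact ih₁.trans ih₂
  | and_congr _ _ ih₁ ih₂ => exact congrArg₂ BrHom.tensor ih₁ ih₂
  | comp_congr _ _ ih₁ ih₂ => exact congrArg₂ BrHom.comp ih₁ ih₂
  | one_comp f => exact BrHom.comp_id _
  | comp_one f => exact BrHom.id_comp _
  | assoc h g f => exact (BrHom.comp_assoc _ _ _).symm
  | and_one A B => exact BrHom.cast_tensor_cast rfl rfl
  | and_comp g₁ f₁ g₂ f₂ => exact BrHom.tensor_comp _ _ _ _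
  | b_nat f g h => exact BrHom.assoc_nat _ _ _
  | delta_nat f => exact BrHom.add_zero_nat _
  | sigma_nat f => exact BrHom.zero_add_nat _
  | c_nat f g => exact BrHom.flip_nat _ _
  | bL_bR A B C => exact BrHom.cast_comp_cast _ _
  | bR_bL A B C => exact BrHom.cast_comp_cast _ _
  | b5 A B C D => exact BrHom.pentagon _ _ _ _
  | deltaL_deltaR A => exact BrHom.cast_comp_cast _ _
  | deltaR_deltaL A => exact BrHom.cast_comp_cast _ _
  | sigmaL_sigmaR A => exact BrHom.cast_comp_cast _ _
  | sigmaR_sigmaL A => exact BrHom.cast_comp_cast _ _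
  | b_delta_sigma A C => exact BrHom.triangle _ _
  | cc A B => exact BrHom.flip_flip _ _
  | bc A B C => exact (BrHom.hexagon _ _ _).symm
  | rt_delta x y => exact BrHom.cup_cap_right
  | rt_sigma x y => exact BrHom.cup_cap_left
  | tb x y z u => exact BrHom.cup_assoc

/-- The functor `G` from `S_≤` to `Br`. -/
def SLe.toBr (V : Type*) : CategoryTheory.Functor (SLe V) Br where
  obj A := Formula.size A
  map f := Quotient.lift ArrowTerm.diagram (fun _ _ h => ArrowTerm.Equal.diagram_eq h) f
  map_id _ := rfl
  map_comp := by
    rintro A B C ⟨f⟩ ⟨g⟩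
    rfl

/-! Two facts give faithfulness: every arrow is, up to coherence isomorphisms, the arrow of a normal
form, and a normal form can be read off its diagram.

Since `S_≤` is symmetric monoidal, formulae may be replaced by lists of atoms. The equations for `r`
and `t` say that `t` is an associative composition with units `r`. Hence each target atom `x ≤ z`
should come from a chain of source atoms `x ≤ y₁`, `y₁ ≤ y₂`, ..., composed by `t` and closed by
`r`, where each source atom is used exactly once. A `NormalForm` records these chains together with
the positions of the atoms used. Positions, and not just atoms, are needed because the same atom may
occur several times.

For existence, call an arrow `h` normality-preserving if `f ≫ h` is normal whenever `f` is. As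
identities are normal, a preserving arrow is normal itself. Preserving arrows are closed under
composition and under whiskering by an atom, so only three generators matter: introducing `x ≤ x`,
composing the first two atoms (concatenation of chains), and exchanging the first two atoms. All
other structure becomes trivial, or reduces to these, after flattening (`preservesNormal_flatMap`).

For uniqueness, a diagram is tested by the truth assignments constant on its classes; composition of
diagrams becomes composition of relations. The line at the left variable of the first target atom
ends either at the right variable of the same atom, and then the chain is empty, or at the left
variable of a source atom, which is then the first link of the chain. Peeling off that link and
inducting recovers the normal form (`normalForm_eq_of_rel_eq`). -/

open CategoryTheory MonoidalCategory

/-! ## The symmetric monoidal structure of `S_≤` -/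

namespace SLe

variable {V : Type*}

/-- The arrow of `S_≤` given by an arrow term. -/
def ofTerm {A B : Formula V} (f : ArrowTerm A B) : (show SLe V from A) ⟶ (show SLe V from B) :=
  Quotient.mk _ f

theorem ofTerm_eq {A B : Formula V} {f g : ArrowTerm A B} (h : ArrowTerm.Equal f g) :
    ofTerm f = ofTerm g := Quotient.sound h

theorem ofTerm_surjective {A B : SLe V} (f : A ⟶ B) :
    ∃ f' : ArrowTerm (V := V) A B, ofTerm f' = f := Quotient.exists_rep f

instance monoidalCategoryStruct : MonoidalCategoryStruct (SLe V) where
  tensorObj A B := Formula.conj A B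
  tensorUnit := Formula.top
  tensorHom f g := Quotient.map₂ (fun f g => f ⋏ g)
    (fun _ _ h₁ _ _ h₂ => ArrowTerm.Equal.and_congr h₁ h₂) f g
  whiskerLeft A _ _ g := Quotient.map (fun g => ArrowTerm.one A ⋏ g)
    (fun _ _ h => ArrowTerm.Equal.and_congr (.refl _) h) g
  whiskerRight f B := Quotient.map (fun f => f ⋏ ArrowTerm.one B)
    (fun _ _ h => ArrowTerm.Equal.and_congr h (.refl _)) f
  associator A B C :=
    { hom := ofTerm (.bL A B C)
      inv := ofTerm (.bR A B C)
      hom_inv_id := ofTerm_eq (.bR_bL A B C)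
      inv_hom_id := ofTerm_eq (.bL_bR A B C) }
  leftUnitor A :=
    { hom := ofTerm (.sigmaR A)
      inv := ofTerm (.sigmaL A)
      hom_inv_id := ofTerm_eq (.sigmaL_sigmaR A)
      inv_hom_id := ofTerm_eq (.sigmaR_sigmaL A) }
  rightUnitor A :=
    { hom := ofTerm (.deltaR A)
      inv := ofTerm (.deltaL A)
      hom_inv_id := ofTerm_eq (.deltaL_deltaR A)
      inv_hom_id := ofTerm_eq (.deltaR_deltaL A) }

theorem inv_associator_naturality {A B C D E F : SLe V} (f : A ⟶ D) (g : B ⟶ E) (h : C ⟶ F) :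
    (α_ A B C).inv ≫ ((f ⊗ₘ g) ⊗ₘ h) = (f ⊗ₘ (g ⊗ₘ h)) ≫ (α_ D E F).inv := by
  obtain ⟨f, rfl⟩ := ofTerm_surjective f
  obtain ⟨g, rfl⟩ := ofTerm_surjective g
  obtain ⟨h, rfl⟩ := ofTerm_surjective h
  exact ofTerm_eq (.b_nat f g h)

instance monoidalCategory : MonoidalCategory (SLe V) :=
  have comp_tensor {A₁ B₁ C₁ A₂ B₂ C₂ : SLe V} (f₁ : A₁ ⟶ B₁) (f₂ : A₂ ⟶ B₂) (g₁ : B₁ ⟶ C₁)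
      (g₂ : B₂ ⟶ C₂) : (f₁ ⊗ₘ f₂) ≫ (g₁ ⊗ₘ g₂) = (f₁ ≫ g₁) ⊗ₘ (f₂ ≫ g₂) := by
    obtain ⟨f₁, rfl⟩ := ofTerm_surjective f₁
    obtain ⟨f₂, rfl⟩ := ofTerm_surjective f₂
    obtain ⟨g₁, rfl⟩ := ofTerm_surjective g₁
    obtain ⟨g₂, rfl⟩ := ofTerm_surjective g₂
    exact ofTerm_eq (.symm (.and_comp g₁ f₁ g₂ f₂))
  have one_tensor (A B : SLe V) : 𝟙 A ⊗ₘ 𝟙 B = 𝟙 (A ⊗ B) := ofTerm_eq (.and_one A B)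
  .ofTensorHom
    (id_tensorHom_id := one_tensor)
    (id_tensorHom := by
      intro A _ _ f
      obtain ⟨f, rfl⟩ := ofTerm_surjective f
      rfl)
    (tensorHom_id := by
      intro _ _ f B
      obtain ⟨f, rfl⟩ := ofTerm_surjective f
      rfl)
    (tensorHom_comp_tensorHom := comp_tensor)
    (associator_naturality := by
      intro _ _ _ _ _ _ f g h
      rw [← Iso.inv_comp_eq, ← Category.assoc, inv_associator_naturality, Category.assoc,
        Iso.inv_hom_id, Category.comp_id])
    (leftUnitor_naturality := by
      intro _ _ f
      obtain ⟨f, rfl⟩ := ofTerm_surjective f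
      exact ofTerm_eq (.symm (.sigma_nat f)))
    (rightUnitor_naturality := by
      intro _ _ f
      obtain ⟨f, rfl⟩ := ofTerm_surjective f
      exact ofTerm_eq (.symm (.delta_nat f)))
    (pentagon := by
      intro A B C D
      have h : (α_ A B (C ⊗ D)).inv ≫ (α_ (A ⊗ B) C D).inv =
          ((𝟙 A ⊗ₘ (α_ B C D).inv) ≫ (α_ A (B ⊗ C) D).inv) ≫ ((α_ A B C).inv ⊗ₘ 𝟙 D) :=
        ofTerm_eq (.b5 A B C D)
      -- The axiom `h` is the pentagon for the inverse associators `b^→`. Both sides are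
      -- postcomposed with two inverse associators so that `h` applies and everything cancels.
      rw [← cancel_mono (α_ A B (C ⊗ D)).inv, ← cancel_mono (α_ (A ⊗ B) C D).inv]
      simp only [Category.assoc, h, Iso.hom_inv_id]
      rw [reassoc_of% comp_tensor (𝟙 A) (α_ B C D).hom, Iso.hom_inv_id, Category.id_comp,
        one_tensor, Iso.hom_inv_id, Category.id_comp, Iso.hom_inv_id_assoc, comp_tensor,
        Iso.hom_inv_id, Category.comp_id, one_tensor])
    (triangle := by
      intro A B
      have h : (α_ A (𝟙_ _) B).inv = (𝟙 A ⊗ₘ (λ_ B).hom) ≫ ((ρ_ A).inv ⊗ₘ 𝟙 B) :=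
        ofTerm_eq (.b_delta_sigma A B)
      rw [← Iso.eq_inv_comp, h, Category.assoc, comp_tensor, Iso.inv_hom_id, Category.comp_id,
        one_tensor]
      exact (Category.comp_id _).symm)

theorem braiding_naturality {A B D E : SLe V} (f : A ⟶ D) (g : B ⟶ E) :
    ofTerm (.c A B) ≫ (g ⊗ₘ f) = (f ⊗ₘ g) ≫ ofTerm (.c D E) := by
  obtain ⟨f, rfl⟩ := ofTerm_surjective f
  obtain ⟨g, rfl⟩ := ofTerm_surjective g
  exact ofTerm_eq (.c_nat f g)

/-- The arrow `c` as an isomorphism. -/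
def braidingIso (A B : SLe V) : A ⊗ B ≅ B ⊗ A where
  hom := ofTerm (.c A B)
  inv := ofTerm (.c B A)
  hom_inv_id := ofTerm_eq (.cc A B)
  inv_hom_id := ofTerm_eq (.cc B A)

/-- The axiom `bc` solved for the associators. As an equality of isomorphisms it yields both
hexagons: the second is its inverse with the objects permuted, because the inverse of `c` is again
`c`. -/
theorem braidingIso_hexagon (A B C : SLe V) :
    α_ A B C ≪≫ braidingIso A (B ⊗ C) ≪≫ α_ B C A =
      whiskerRightIso (braidingIso A B) C ≪≫ α_ B A C ≪≫ whiskerLeftIso B (braidingIso A C) := by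
  have h : (braidingIso A (B ⊗ C)).hom = ((((α_ A B C).inv ≫ (braidingIso A B).hom ▷ C) ≫
      (α_ B A C).hom) ≫ B ◁ (braidingIso A C).hom) ≫ (α_ B C A).inv := ofTerm_eq (.bc A B C)
  ext
  simp [h]

instance symmetricCategory : SymmetricCategory (SLe V) where
  braiding := braidingIso
  braiding_naturality_right A B C f := by
    rw [← id_tensorHom, ← tensorHom_id]
    exact (braiding_naturality (𝟙 A) f).symm
  braiding_naturality_left f C := by
    rw [← id_tensorHom, ← tensorHom_id]
    exact (braiding_naturality f (𝟙 C)).symm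
  hexagon_forward A B C := congrArg Iso.hom (braidingIso_hexagon A B C)
  hexagon_reverse A B C := by
    have h := congrArg Iso.inv (braidingIso_hexagon C A B)
    simp only [Iso.trans_inv, Category.assoc, whiskerLeftIso_inv, whiskerRightIso_inv] at h
    exact h
  symmetry A B := ofTerm_eq (.cc A B)

end SLe

/-! ## Exchange of the first two factors -/

namespace CategoryTheory.MonoidalCategory

variable {C : Type*} [Category C] [MonoidalCategory C] [SymmetricCategory C]

/-- The exchange of the first two of three factors. -/
def exchange (A B X : C) : A ⊗ (B ⊗ X) ⟶ B ⊗ (A ⊗ X) :=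
  (α_ A B X).inv ≫ (β_ A B).hom ▷ X ≫ (α_ B A X).hom

@[simp]
theorem exchange_exchange (A B X : C) : exchange A B X ≫ exchange B A X = 𝟙 _ := by
  simp [exchange, ← comp_whiskerRight_assoc]

theorem exchange_naturality_right (A B : C) {X Y : C} (f : X ⟶ Y) :
    A ◁ B ◁ f ≫ exchange A B Y = exchange A B X ≫ B ◁ A ◁ f := by
  simp only [exchange, Category.assoc]
  rw [associator_inv_naturality_right_assoc, whisker_exchange_assoc,
    associator_naturality_right]

theorem exchange_naturality_left {A A' : C} (f : A ⟶ A') (B X : C) :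
    f ▷ (B ⊗ X) ≫ exchange A' B X = exchange A B X ≫ B ◁ f ▷ X := by
  simp only [exchange, Category.assoc]
  rw [associator_inv_naturality_left_assoc, ← comp_whiskerRight_assoc,
    BraidedCategory.braiding_naturality_left, comp_whiskerRight_assoc,
    associator_naturality_middle]

theorem exchange_naturality_middle (A : C) {B B' : C} (f : B ⟶ B') (X : C) :
    A ◁ f ▷ X ≫ exchange A B' X = exchange A B X ≫ f ▷ (A ⊗ X) := by
  simp only [exchange, Category.assoc]
  rw [associator_inv_naturality_middle_assoc, ← comp_whiskerRight_assoc,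
    BraidedCategory.braiding_naturality_right, comp_whiskerRight_assoc,
    associator_naturality_left]

/-- The hexagon in context. This and `exchange_tensor_right` reduce exchanges of compound formulae
to exchanges of atoms. -/
theorem exchange_tensor_left (A B D X : C) :
    exchange (A ⊗ B) D X = (α_ A B (D ⊗ X)).hom ≫ A ◁ exchange B D X ≫ exchange A D (B ⊗ X) ≫
      D ◁ (α_ A B X).inv := by
  simp [exchange, BraidedCategory.braiding_tensor_left_hom]

theorem exchange_tensor_right (A B D X : C) :
    exchange A (B ⊗ D) X = A ◁ (α_ B D X).hom ≫ exchange A B (D ⊗ X) ≫ B ◁ exchange A D X ≫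
      (α_ B D (A ⊗ X)).inv := by
  simp [exchange, BraidedCategory.braiding_tensor_right_hom]

theorem exchange_unit_left (B X : C) : exchange (𝟙_ C) B X = (λ_ (B ⊗ X)).hom ≫ B ◁ (λ_ X).inv := by
  simp [exchange, braiding_tensorUnit_left]

theorem exchange_unit_right (A X : C) :
    exchange A (𝟙_ C) X = A ◁ (λ_ X).hom ≫ (λ_ (A ⊗ X)).inv := by
  simp [exchange, braiding_tensorUnit_right]

/-- The Yang–Baxter equation. -/
theorem exchange_yang_baxter (A B D X : C) :
    exchange A B (D ⊗ X) ≫ B ◁ exchange A D X ≫ exchange B D (A ⊗ X) =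
      A ◁ exchange B D X ≫ exchange A D (B ⊗ X) ≫ D ◁ exchange A B X := by
  -- Yang–Baxter is naturality of the exchange of `A` with `B ⊗ D` along the braiding of `B` and
  -- `D`, with both exchanges expanded by the hexagon.
  have h := exchange_naturality_middle A (β_ B D).hom X
  have e (Y : C) : (β_ B D).hom ▷ Y = (α_ B D Y).hom ≫ exchange B D Y ≫ (α_ D B Y).inv := by
    simp [exchange]
  rw [exchange_tensor_right, exchange_tensor_right, e, e] at h
  rw [← cancel_mono (α_ D B (A ⊗ X)).inv, ← cancel_epi (A ◁ (α_ B D X).hom)]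
  simpa using h.symm

end CategoryTheory.MonoidalCategory

/-! ## Normal forms -/

/-- `Insertion a X X'`: the list `X'` is obtained from `X` by inserting `a` at some position. -/
inductive Insertion {α : Type*} (a : α) : List α → List α → Type _ where
  | here (X : List α) : Insertion a X (a :: X)
  | there (b : α) {X X' : List α} (i : Insertion a X X') : Insertion a (b :: X) (b :: X')

/-- Normal forms of arrows between lists of atomic formulae: every atomic formula of the target
is composed from a list of atomic formulae of the source. -/
inductive NormalForm {V : Type*} : List (V × V) → List (V × V) → Type _ where
  | nil : NormalForm [] []
  | refl (x : V) {X Y : List (V × V)} (f : NormalForm X Y) : NormalForm X ((x, x) :: Y)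
  | trans {x y z : V} {X X' Y : List (V × V)} (i : Insertion (x, y) X X')
      (f : NormalForm X ((y, z) :: Y)) : NormalForm X' ((x, z) :: Y)

namespace SLe

variable {V : Type*}

/-- The atomic formula of a pair of variables. -/
def atom (a : V × V) : SLe V := Formula.le a.1 a.2

/-- The conjunction of a list of atomic formulae, associated to the right. -/
def ofList : List (V × V) → SLe V
  | [] => 𝟙_ (SLe V)
  | a :: X => atom a ⊗ ofList X

/-- The arrow `r`. -/
def rArrow (x : V) : 𝟙_ (SLe V) ⟶ atom (x, x) := ofTerm (.r x)

/-- The arrow `t`. -/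
def tArrow (x y z : V) : atom (x, y) ⊗ atom (y, z) ⟶ atom (x, z) := ofTerm (.t x y z)

/-- The arrow that introduces `x ≤ x` in front of a formula. -/
def introRefl (x : V) (A : SLe V) : A ⟶ atom (x, x) ⊗ A := (λ_ A).inv ≫ rArrow x ▷ A

/-- The arrow that composes the first two of three factors by `t`. -/
def composeFirst (x y z : V) (A : SLe V) :
    atom (x, y) ⊗ (atom (y, z) ⊗ A) ⟶ atom (x, z) ⊗ A :=
  (α_ _ _ _).inv ≫ tArrow x y z ▷ A

/-! ### Laws of `r` and `t` in front of a context -/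

theorem introRefl_naturality (x : V) {A B : SLe V} (f : A ⟶ B) :
    f ≫ introRefl x B = introRefl x A ≫ atom (x, x) ◁ f := by
  simp only [introRefl, Category.assoc]
  rw [leftUnitor_inv_naturality_assoc, whisker_exchange]

theorem composeFirst_naturality (x y z : V) {A B : SLe V} (f : A ⟶ B) :
    atom (x, y) ◁ atom (y, z) ◁ f ≫ composeFirst x y z B = composeFirst x y z A ≫ _ ◁ f := by
  simp only [composeFirst, Category.assoc]
  rw [associator_inv_naturality_right_assoc, whisker_exchange]

theorem introRefl_composeFirst (x y : V) (A : SLe V) :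
    introRefl x (atom (x, y) ⊗ A) ≫ composeFirst x x y A = 𝟙 _ := by
  have h : rArrow x ▷ atom (x, y) ≫ tArrow x x y = (λ_ (atom (x, y))).hom :=
    ofTerm_eq (.rt_sigma y x)
  simp only [introRefl, composeFirst, Category.assoc]
  rw [associator_inv_naturality_left_assoc, ← comp_whiskerRight, h]
  simp

theorem whiskerLeft_introRefl_composeFirst (x y : V) (A : SLe V) :
    atom (x, y) ◁ introRefl y A ≫ composeFirst x y y A = 𝟙 _ := by
  have h : atom (x, y) ◁ rArrow y ≫ tArrow x y y = (ρ_ (atom (x, y))).hom :=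
    ofTerm_eq (.rt_delta x y)
  simp only [introRefl, composeFirst, whiskerLeft_comp, Category.assoc]
  rw [associator_inv_naturality_middle_assoc, ← comp_whiskerRight, h]
  simp

theorem composeFirst_assoc (x y z u : V) (A : SLe V) :
    atom (x, y) ◁ composeFirst y z u A ≫ composeFirst x y u A =
      composeFirst x y z (atom (z, u) ⊗ A) ≫ composeFirst x z u A := by
  have h : atom (x, y) ◁ tArrow y z u ≫ tArrow x y u =
      ((α_ _ _ _).inv ≫ tArrow x y z ▷ atom (z, u)) ≫ tArrow x z u :=
    ofTerm_eq (.tb x y z u)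
  simp only [composeFirst, whiskerLeft_comp, Category.assoc]
  rw [associator_inv_naturality_middle_assoc, ← comp_whiskerRight, h,
    associator_inv_naturality_left_assoc]
  simp

/-- By naturality the exchange acts on the unit before `r` is applied, and exchanging with the unit
is only a matter of unitors. -/
theorem introRefl_exchange (x : V) (B A : SLe V) :
    introRefl x (B ⊗ A) ≫ exchange (atom (x, x)) B A = B ◁ introRefl x A := by
  simp only [introRefl, Category.assoc, exchange_naturality_left, exchange_unit_left]
  simp

theorem whiskerLeft_introRefl_exchange (x : V) (B A : SLe V) :
    B ◁ introRefl x A ≫ exchange B (atom (x, x)) A = introRefl x (B ⊗ A) := by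
  rw [← introRefl_exchange, Category.assoc, exchange_exchange, Category.comp_id]

/-- Naturality of the exchange moves `t` across, and the hexagon splits the passage of `B` into one
passage for each of the two atoms composed. -/
theorem whiskerLeft_composeFirst_exchange (x y z : V) (B A : SLe V) :
    B ◁ composeFirst x y z A ≫ exchange B (atom (x, z)) A =
      exchange B (atom (x, y)) (atom (y, z) ⊗ A) ≫ atom (x, y) ◁ exchange B (atom (y, z)) A ≫
        composeFirst x y z (B ⊗ A) := by
  simp only [composeFirst, whiskerLeft_comp, Category.assoc, exchange_naturality_middle,
    exchange_tensor_right]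
  simp

theorem composeFirst_exchange (x y z : V) (B A : SLe V) :
    composeFirst x y z (B ⊗ A) ≫ exchange (atom (x, z)) B A =
      atom (x, y) ◁ exchange (atom (y, z)) B A ≫ exchange (atom (x, y)) B (atom (y, z) ⊗ A) ≫
        B ◁ composeFirst x y z A := by
  simp only [composeFirst, whiskerLeft_comp, Category.assoc, exchange_naturality_left,
    exchange_tensor_left]
  simp

/-- The arrow that moves the inserted atomic formula to the front. -/
def insertionHom {a : V × V} : ∀ {X X' : List (V × V)}, Insertion a X X' →
    (ofList X' ⟶ atom a ⊗ ofList X)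
  | _, _, .here _ => 𝟙 _
  | _, _, .there b i => atom b ◁ insertionHom i ≫ exchange _ _ _

/-- The arrow of a normal form. -/
def normalHom : ∀ {X Y : List (V × V)}, NormalForm X Y → (ofList X ⟶ ofList Y)
  | _, _, .nil => 𝟙 _
  | _, _, .refl x f => introRefl x _ ≫ atom (x, x) ◁ normalHom f
  | _, _, .trans (x := x) (y := y) (z := z) i f =>
      insertionHom i ≫ atom (x, y) ◁ normalHom f ≫ composeFirst x y z _

/-- The list `X` is its own normal form. -/
def idNormalForm : ∀ X : List (V × V), NormalForm X X
  | [] => .nil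
  -- Every chain ends in a reflexivity, so a single atom is represented as itself composed with `r`.
  | (_, y) :: X => .trans (.here X) (.refl y (idNormalForm X))

/-- The right unit law for `t` removes the `r` that closes each one-link chain. -/
theorem normalHom_id : ∀ X : List (V × V), normalHom (idNormalForm X) = 𝟙 _
  | [] => rfl
  | (x, y) :: X => by
    simp only [idNormalForm, normalHom, normalHom_id X, insertionHom]
    erw [whiskerLeft_id, Category.comp_id, Category.id_comp]
    exact whiskerLeft_introRefl_composeFirst x y _

/-- The arrow is given by a normal form. -/
def IsNormal {X Y : List (V × V)} (f : ofList X ⟶ ofList Y) : Prop := ∃ n, normalHom n = f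

theorem IsNormal.congr {X Y : List (V × V)} {f g : ofList X ⟶ ofList Y} (hf : IsNormal f)
    (e : f = g) : IsNormal g := e ▸ hf

/-- Composition with the arrow after it preserves normality. -/
def PreservesNormal {Y Z : List (V × V)} (h : ofList Y ⟶ ofList Z) : Prop :=
  ∀ X (f : ofList X ⟶ ofList Y), IsNormal f → IsNormal (f ≫ h)

theorem PreservesNormal.id (Y : List (V × V)) : PreservesNormal (𝟙 (ofList Y)) := fun _ f hf => by
  rwa [Category.comp_id]

theorem PreservesNormal.comp {X Y Z : List (V × V)} {f : ofList X ⟶ ofList Y}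
    {g : ofList Y ⟶ ofList Z} (hf : PreservesNormal f) (hg : PreservesNormal g) :
    PreservesNormal (f ≫ g) := fun _ e he => by
  rw [← Category.assoc]
  exact hg _ _ (hf _ _ he)

theorem PreservesNormal.isNormal {X Y : List (V × V)} {f : ofList X ⟶ ofList Y}
    (hf : PreservesNormal f) : IsNormal f := by
  simpa using hf _ (𝟙 _) ⟨_, normalHom_id X⟩

theorem isNormal_refl (x : V) {X Y : List (V × V)} {f : ofList X ⟶ ofList Y} (hf : IsNormal f) :
    IsNormal (X := X) (Y := (x, x) :: Y) (introRefl x _ ≫ atom (x, x) ◁ f) := by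
  obtain ⟨n, rfl⟩ := hf
  exact ⟨.refl x n, rfl⟩

theorem isNormal_trans {x y z : V} {X X' Y : List (V × V)} (i : Insertion (x, y) X X')
    {f : ofList X ⟶ atom (y, z) ⊗ ofList Y} (hf : IsNormal (Y := (y, z) :: Y) f) :
    IsNormal (X := X') (Y := (x, z) :: Y)
      (insertionHom i ≫ atom (x, y) ◁ f ≫ composeFirst x y z _) := by
  obtain ⟨n, rfl⟩ := hf
  exact ⟨.trans i n, rfl⟩

/-! ### Closure of normal forms under composition -/

/-- The chain of the head `b` is left unchanged: `h` commutes with each of its links, and once the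
chain is used up the hypothesis on `h` applies to the rest. -/
theorem isNormal_comp_whiskerLeft {Y Z : List (V × V)} {h : ofList Y ⟶ ofList Z}
    (hh : PreservesNormal h) : ∀ {X : List (V × V)} {b : V × V} (n : NormalForm X (b :: Y)),
    IsNormal (Y := b :: Z) ((show ofList X ⟶ atom b ⊗ ofList Y from normalHom n) ≫ atom b ◁ h)
  | X, _, .refl x f => by
    have e : introRefl x (ofList X) ≫ atom (x, x) ◁ (normalHom f ≫ h) =
        (introRefl x _ ≫ atom (x, x) ◁ normalHom f) ≫ atom (x, x) ◁ h := by simp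
    exact (isNormal_refl x (hh _ _ ⟨f, rfl⟩)).congr e
  | _, _, .trans (x := x) (y := y) (z := z) (X := X) i f => by
    -- The identity holds for any `g` in place of `normalHom f`. Giving `g` an explicit tensor
    -- product as target makes the monoidal equations applicable.
    have e (g : ofList X ⟶ atom (y, z) ⊗ ofList Y) :
        insertionHom i ≫ atom (x, y) ◁ (g ≫ atom (y, z) ◁ h) ≫ composeFirst x y z _ =
          (insertionHom i ≫ atom (x, y) ◁ g ≫ composeFirst x y z _) ≫ atom (x, z) ◁ h := by
      simp [composeFirst_naturality]
    exact (isNormal_trans i (isNormal_comp_whiskerLeft hh f)).congr (e _)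

theorem preservesNormal_whiskerLeft (b : V × V) {Y Z : List (V × V)} {h : ofList Y ⟶ ofList Z}
    (hh : PreservesNormal h) :
    PreservesNormal (Y := b :: Y) (Z := b :: Z) (atom b ◁ h) := by
  rintro X _ ⟨n, rfl⟩
  exact isNormal_comp_whiskerLeft hh n

theorem preservesNormal_introRefl (x : V) (Y : List (V × V)) :
    PreservesNormal (Y := Y) (Z := (x, x) :: Y) (introRefl x (ofList Y)) := by
  intro X f hf
  exact (isNormal_refl x hf).congr (introRefl_naturality x f).symm

/-- Concatenation of two chains, with the recursion of list append: the left unit law handles the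
empty first chain, associativity of `t` handles a further link. -/
theorem isNormal_comp_composeFirst {Y : List (V × V)} {z : V} :
    ∀ {X : List (V × V)} {x y : V} (n : NormalForm X ((x, y) :: (y, z) :: Y)),
    IsNormal (Y := (x, z) :: Y)
      ((show ofList X ⟶ atom (x, y) ⊗ (atom (y, z) ⊗ ofList Y) from normalHom n) ≫
        composeFirst x y z _)
  | X, _, _, .refl x f => by
    have e (g : ofList X ⟶ atom (x, z) ⊗ ofList Y) :
        (introRefl x _ ≫ atom (x, x) ◁ g) ≫ composeFirst x x z _ = g := by
      rw [← introRefl_naturality, Category.assoc, introRefl_composeFirst, Category.comp_id]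
    exact ⟨f, (e _).symm⟩
  | _, _, _, .trans (x := x) (y := w) (z := y) (X := X) i f => by
    have e (g : ofList X ⟶ atom (w, y) ⊗ (atom (y, z) ⊗ ofList Y)) :
        insertionHom i ≫ atom (x, w) ◁ (g ≫ composeFirst w y z _) ≫ composeFirst x w z _ =
          (insertionHom i ≫ atom (x, w) ◁ g ≫ composeFirst x w y _) ≫ composeFirst x y z _ := by
      simp [composeFirst_assoc]
    exact (isNormal_trans i (isNormal_comp_composeFirst f)).congr (e _)

theorem preservesNormal_composeFirst (x y z : V) (Y : List (V × V)) :
    PreservesNormal (Y := (x, y) :: (y, z) :: Y) (Z := (x, z) :: Y)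
      (composeFirst x y z (ofList Y)) := by
  rintro X _ ⟨n, rfl⟩
  exact isNormal_comp_composeFirst n

/-- Two successive insertions can be interchanged. -/
theorem exists_insertion_exchange : ∀ {a c : V × V} {W X X' : List (V × V)}
    (i : Insertion a X X') (j : Insertion c W X),
    ∃ (Z : List (V × V)) (j' : Insertion c Z X') (i' : Insertion a W Z),
      insertionHom i ≫ atom a ◁ insertionHom j ≫ exchange (atom a) (atom c) (ofList W) =
        insertionHom j' ≫ atom c ◁ insertionHom i'
  | a, c, W, _, _, .here X, j => by
    refine ⟨_, .there a j, .here W, ?_⟩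
    have e (g : ofList X ⟶ atom c ⊗ ofList W) :
        𝟙 _ ≫ atom a ◁ g ≫ exchange _ _ _ = (atom a ◁ g ≫ exchange _ _ _) ≫ atom c ◁ 𝟙 _ := by
      simp
    exact e _
  | a, _, _, _, _, .there b (X := X) (X' := X') i, .here _ => by
    refine ⟨_, .here _, i, ?_⟩
    have e (g : ofList X' ⟶ atom a ⊗ ofList X) :
        (atom b ◁ g ≫ exchange _ _ _) ≫ atom a ◁ 𝟙 _ ≫ exchange _ _ _ = 𝟙 _ ≫ atom b ◁ g := by
      simp
    exact e _
  | a, c, _, _, _, .there b (X := X) (X' := X') i, .there _ (X := W) j => by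
    obtain ⟨Z, j', i', h⟩ := exists_insertion_exchange i j
    refine ⟨_, .there b j', .there b i', ?_⟩
    have e : (atom b ◁ insertionHom i ≫ exchange _ _ _) ≫
        atom a ◁ (atom b ◁ insertionHom j ≫ exchange _ _ _) ≫ exchange _ _ _ =
        (atom b ◁ insertionHom j' ≫ exchange _ _ _) ≫
          atom c ◁ (atom b ◁ insertionHom i' ≫ exchange _ _ _) := by
      -- The front atom `b` has to pass both `a` and `c`. Naturality collects the three exchanges,
      -- Yang–Baxter reorders them, and `h` then applies behind `b`.
      simp only [whiskerLeft_comp, Category.assoc]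
      rw [← reassoc_of% exchange_naturality_right, exchange_yang_baxter,
        ← reassoc_of% exchange_naturality_right]
      simp only [← whiskerLeft_comp_assoc, h]
    exact e

/-- Prefixing a link to the second chain of a normal form, as needed when two target atoms are
exchanged. The new source atom travels past the links of the first chain; each time,
`exists_insertion_exchange` alters the order in which two source atoms are extracted. -/
theorem isNormal_insert_composeSecond {Y : List (V × V)} {x y z : V} :
    ∀ {X X' : List (V × V)} {b : V × V} (i : Insertion (x, y) X X')
      (n : NormalForm X (b :: (y, z) :: Y)),
    IsNormal (Y := b :: (x, z) :: Y)
      (insertionHom i ≫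
        atom (x, y) ◁ (show ofList X ⟶ atom b ⊗ (atom (y, z) ⊗ ofList Y) from normalHom n) ≫
          exchange (atom (x, y)) (atom b) (atom (y, z) ⊗ ofList Y) ≫
            atom b ◁ composeFirst x y z _)
  | X, X', _, i, .refl w f => by
    have e (g : ofList X ⟶ atom (y, z) ⊗ ofList Y) :
        introRefl w (ofList X') ≫
          atom (w, w) ◁ (insertionHom i ≫ atom (x, y) ◁ g ≫ composeFirst x y z _) =
        insertionHom i ≫ atom (x, y) ◁ (introRefl w _ ≫ atom (w, w) ◁ g) ≫ exchange _ _ _ ≫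
            atom (w, w) ◁ composeFirst x y z _ := by
      simp only [whiskerLeft_comp, Category.assoc]
      rw [reassoc_of% exchange_naturality_right,
        reassoc_of% whiskerLeft_introRefl_exchange, ← reassoc_of% introRefl_naturality]
    exact (isNormal_refl w (isNormal_trans i ⟨f, rfl⟩)).congr (e _)
  | _, X', _, i, .trans (x := w) (y := v) (z := u) (X := W) j f => by
    obtain ⟨Z, j', i', h⟩ := exists_insertion_exchange i j
    have e (g : ofList W ⟶ atom (v, u) ⊗ (atom (y, z) ⊗ ofList Y)) :
        insertionHom j' ≫ atom (w, v) ◁ (insertionHom i' ≫ atom (x, y) ◁ g ≫ exchange _ _ _ ≫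
            atom (v, u) ◁ composeFirst x y z _) ≫ composeFirst w v u _ =
        insertionHom i ≫
          atom (x, y) ◁ (insertionHom j ≫ atom (w, v) ◁ g ≫ composeFirst w v u _) ≫
            exchange _ _ _ ≫ atom (w, u) ◁ composeFirst x y z _ := by
      simp only [whiskerLeft_comp, Category.assoc]
      rw [← reassoc_of% h, reassoc_of% whiskerLeft_composeFirst_exchange,
        reassoc_of% exchange_naturality_right, composeFirst_naturality]
    exact (isNormal_trans j' (isNormal_insert_composeSecond i' f)).congr (e _)

/-- Recursion on the chain of `a`. If it is empty, `r` is introduced behind `b` instead. Otherwise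
the rest of the chain is exchanged first, and its first link is then put back in second place by
`isNormal_insert_composeSecond`. -/
theorem isNormal_comp_exchange {Y : List (V × V)} {b : V × V} :
    ∀ {X : List (V × V)} {a : V × V} (n : NormalForm X (a :: b :: Y)),
    IsNormal (Y := b :: a :: Y)
      ((show ofList X ⟶ atom a ⊗ (atom b ⊗ ofList Y) from normalHom n) ≫
        exchange (atom a) (atom b) (ofList Y))
  | X, _, .refl x f => by
    have e (g : ofList X ⟶ atom b ⊗ ofList Y) :
        g ≫ atom b ◁ introRefl x _ =
          (introRefl x _ ≫ atom (x, x) ◁ g) ≫ exchange _ _ _ := by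
      rw [← introRefl_naturality, Category.assoc, introRefl_exchange]
    exact (preservesNormal_whiskerLeft b (preservesNormal_introRefl x Y) _ _ ⟨f, rfl⟩).congr
      (e _)
  | _, _, .trans (x := x) (y := y) (z := z) (X := X) i f => by
    have e (g : ofList X ⟶ atom (y, z) ⊗ (atom b ⊗ ofList Y)) :
        insertionHom i ≫ atom (x, y) ◁ (g ≫ exchange _ _ _) ≫ exchange _ _ _ ≫
          atom b ◁ composeFirst x y z _ =
        (insertionHom i ≫ atom (x, y) ◁ g ≫ composeFirst x y z _) ≫ exchange _ _ _ := by
      simp only [whiskerLeft_comp, Category.assoc, composeFirst_exchange]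
    obtain ⟨n, hn⟩ := isNormal_comp_exchange f
    have := isNormal_insert_composeSecond i n
    rw [hn] at this
    exact this.congr (e _)

theorem preservesNormal_exchange (a b : V × V) (Y : List (V × V)) :
    PreservesNormal (Y := a :: b :: Y) (Z := b :: a :: Y)
      (exchange (atom a) (atom b) (ofList Y)) := by
  rintro X _ ⟨n, rfl⟩
  exact isNormal_comp_exchange n

end SLe

/-! ### Flattening of formulae to lists -/

/-- The list of the atomic formulae of `A`, followed by `Y`. -/
def Formula.flatten {V : Type*} : Formula V → List (V × V) → List (V × V)
  | .le x y, Y => (x, y) :: Y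
  | .top, Y => Y
  | .conj A B, Y => A.flatten (B.flatten Y)

namespace SLe

variable {V : Type*}

/-- The canonical isomorphism between `A ∧ Y` and its flattening. -/
def flattenIso : ∀ (A : Formula V) (Y : List (V × V)),
    tensorObj (C := SLe V) A (ofList Y) ≅ ofList (A.flatten Y)
  | .le _ _, _ => Iso.refl _
  | .top, Y => λ_ (ofList Y)
  | .conj A B, Y => @MonoidalCategoryStruct.associator (SLe V) _ _ A B (ofList Y) ≪≫
      whiskerLeftIso (C := SLe V) A (flattenIso B Y) ≪≫ flattenIso A (B.flatten Y)

theorem PreservesNormal.congr {X Y : List (V × V)} {f g : ofList X ⟶ ofList Y}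
    (hf : PreservesNormal f) (e : f = g) : PreservesNormal g := e ▸ hf

/-- The arrow `A ∧ h` between flattened formulae. -/
def flatWhisker (A : SLe V) {Y Z : List (V × V)} (h : ofList Y ⟶ ofList Z) :
    ofList (Formula.flatten A Y) ⟶ ofList (Formula.flatten A Z) :=
  (flattenIso A Y).inv ≫ A ◁ h ≫ (flattenIso A Z).hom

/-- The arrow `f ∧ Y` between flattened formulae. -/
def flatMap {A B : SLe V} (f : A ⟶ B) (Y : List (V × V)) :
    ofList (Formula.flatten A Y) ⟶ ofList (Formula.flatten B Y) :=
  (flattenIso A Y).inv ≫ f ▷ ofList Y ≫ (flattenIso B Y).hom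

/-- The exchange of two formulae in front of a list, between flattened formulae. -/
def flatExchange (A B : SLe V) (Y : List (V × V)) :
    ofList (Formula.flatten A (Formula.flatten B Y)) ⟶
      ofList (Formula.flatten B (Formula.flatten A Y)) :=
  (flattenIso A _).inv ≫ A ◁ (flattenIso B Y).inv ≫ exchange A B (ofList Y) ≫
    B ◁ (flattenIso A Y).hom ≫ (flattenIso B _).hom

theorem flatWhisker_tensor (A B : SLe V) {Y Z : List (V × V)} (h : ofList Y ⟶ ofList Z) :
    flatWhisker (A ⊗ B) h = flatWhisker A (flatWhisker B h) := by
  -- This is the claim with `flattenIso` unfolded at a conjunction; the remaining equality is purely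
  -- monoidal.
  have e : (α_ A B (ofList Y) ≪≫ whiskerLeftIso A (flattenIso B Y) ≪≫
      flattenIso A (Formula.flatten B Y)).inv ≫ (A ⊗ B) ◁ h ≫
      (α_ A B (ofList Z) ≪≫ whiskerLeftIso A (flattenIso B Z) ≪≫
      flattenIso A (Formula.flatten B Z)).hom = flatWhisker A (flatWhisker B h) := by
    simp [flatWhisker]
  exact e

theorem preservesNormal_flatWhisker (A : Formula V) : ∀ {Y Z : List (V × V)}
    {h : ofList Y ⟶ ofList Z}, PreservesNormal h →
      PreservesNormal (flatWhisker (show SLe V from A) h) := by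
  induction A with
  | le x y =>
    intro Y Z h hh
    have e : atom (x, y) ◁ h = 𝟙 _ ≫ atom (x, y) ◁ h ≫ 𝟙 _ := by simp
    exact (preservesNormal_whiskerLeft (x, y) hh).congr e
  | top =>
    intro Y Z h hh
    have e : h = (λ_ _).inv ≫ 𝟙_ _ ◁ h ≫ (λ_ _).hom := by simp
    exact hh.congr e
  | conj A B ihA ihB =>
    intro Y Z h hh
    exact (ihA (ihB hh)).congr (flatWhisker_tensor _ _ h).symm

theorem flatExchange_tensor_left (A B D : SLe V) (Y : List (V × V)) :
    flatExchange (A ⊗ B) D Y =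
      flatWhisker A (flatExchange B D Y) ≫ flatExchange A D (Formula.flatten B Y) := by
  have e : (α_ A B _ ≪≫ whiskerLeftIso A (flattenIso B _) ≪≫
      flattenIso A (Formula.flatten B (Formula.flatten D Y))).inv ≫
      (A ⊗ B) ◁ (flattenIso D Y).inv ≫ exchange (A ⊗ B) D (ofList Y) ≫
      D ◁ (α_ A B (ofList Y) ≪≫ whiskerLeftIso A (flattenIso B Y) ≪≫
      flattenIso A (Formula.flatten B Y)).hom ≫ (flattenIso D _).hom =
      flatWhisker A (flatExchange B D Y) ≫ flatExchange A D (Formula.flatten B Y) := by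
    simp [flatWhisker, flatExchange, exchange_tensor_left,
      ← reassoc_of% exchange_naturality_right]
  exact e

theorem flatExchange_tensor_right (A B D : SLe V) (Y : List (V × V)) :
    flatExchange A (B ⊗ D) Y =
      flatExchange A B (Formula.flatten D Y) ≫ flatWhisker B (flatExchange A D Y) := by
  have e : (flattenIso A (Formula.flatten B (Formula.flatten D Y))).inv ≫
      A ◁ (α_ B D _ ≪≫ whiskerLeftIso B (flattenIso D _) ≪≫
        flattenIso B (Formula.flatten D Y)).inv ≫ exchange A (B ⊗ D) (ofList Y) ≫
      (B ⊗ D) ◁ (flattenIso A Y).hom ≫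
      (α_ B D _ ≪≫ whiskerLeftIso B (flattenIso D _) ≪≫
        flattenIso B (Formula.flatten D (Formula.flatten A Y))).hom =
      flatExchange A B (Formula.flatten D Y) ≫ flatWhisker B (flatExchange A D Y) := by
    simp [flatWhisker, flatExchange, exchange_tensor_right,
      reassoc_of% exchange_naturality_right]
  exact e

/-- By induction on `B`, the atom `a` passes the atoms of `B` one at a time. The next theorem does
the same for the other argument. -/
theorem preservesNormal_flatExchange_atom (a : V × V) (B : Formula V) :
    ∀ Y : List (V × V), PreservesNormal (flatExchange (atom a) (show SLe V from B) Y) := by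
  induction B with
  | le x y =>
    intro Y
    have e : exchange (atom a) (atom (x, y)) (ofList Y) =
      𝟙 _ ≫ _ ◁ 𝟙 _ ≫ exchange _ _ _ ≫ _ ◁ 𝟙 _ ≫ 𝟙 _ := by simp
    exact (preservesNormal_exchange a (x, y) Y).congr e
  | top =>
    intro Y
    have e : 𝟙 (atom a ⊗ ofList Y) = 𝟙 _ ≫ atom a ◁ (λ_ (ofList Y)).inv ≫
        exchange (atom a) (𝟙_ _) _ ≫ 𝟙_ _ ◁ 𝟙 (atom a ⊗ ofList Y) ≫ (λ_ _).hom := by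
      simp [exchange_unit_right]
    exact (PreservesNormal.id (a :: Y)).congr e
  | conj B D ihB ihD =>
    intro Y
    exact ((ihB _).comp (preservesNormal_flatWhisker B (ihD Y))).congr
      (flatExchange_tensor_right _ _ _ _).symm

theorem preservesNormal_flatExchange (A : Formula V) (B : SLe V) :
    ∀ Y : List (V × V), PreservesNormal (flatExchange (show SLe V from A) B Y) := by
  induction A with
  | le x y => exact preservesNormal_flatExchange_atom (x, y) B
  | top =>
    intro Y
    have e (f : B ⊗ ofList Y ≅ ofList (Formula.flatten B Y)) : 𝟙 _ =
        (λ_ _).inv ≫ 𝟙_ _ ◁ f.inv ≫ exchange (𝟙_ _) B _ ≫ B ◁ (λ_ _).hom ≫ f.hom := by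
      simp [exchange_unit_left]
    exact (PreservesNormal.id _).congr (e _)
  | conj A D ihA ihD =>
    intro Y
    exact ((preservesNormal_flatWhisker A (ihD Y)).comp (ihA _)).congr
      (flatExchange_tensor_left _ _ _ _).symm

theorem flatMap_tensor {A B D E : SLe V} (f : A ⟶ B) (g : D ⟶ E) (Y : List (V × V)) :
    flatMap (f ⊗ₘ g) Y = flatWhisker A (flatMap g Y) ≫ flatMap f (Formula.flatten E Y) := by
  have e : (α_ A D _ ≪≫ whiskerLeftIso A (flattenIso D Y) ≪≫
      flattenIso A (Formula.flatten D Y)).inv ≫ (f ⊗ₘ g) ▷ ofList Y ≫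
      (α_ B E _ ≪≫ whiskerLeftIso B (flattenIso E Y) ≪≫
      flattenIso B (Formula.flatten E Y)).hom =
      flatWhisker A (flatMap g Y) ≫ flatMap f (Formula.flatten E Y) := by
    simp [flatWhisker, flatMap, tensorHom_def', whisker_exchange_assoc]
  exact e

theorem flatMap_braiding (A B : SLe V) (Y : List (V × V)) :
    flatMap (β_ A B).hom Y = flatExchange A B Y := by
  have e : (α_ A B _ ≪≫ whiskerLeftIso A (flattenIso B Y) ≪≫
      flattenIso A (Formula.flatten B Y)).inv ≫ (β_ A B).hom ▷ ofList Y ≫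
      (α_ B A _ ≪≫ whiskerLeftIso B (flattenIso A Y) ≪≫
      flattenIso B (Formula.flatten A Y)).hom = flatExchange A B Y := by
    simp [flatExchange, exchange]
  exact e

theorem flatMap_id (A : SLe V) (Y : List (V × V)) :
    flatMap (𝟙 A) Y = 𝟙 (ofList (Formula.flatten A Y)) := by
  simp [flatMap]

theorem flatMap_comp {A B D : SLe V} (f : A ⟶ B) (g : B ⟶ D) (Y : List (V × V)) :
    flatMap (f ≫ g) Y = flatMap f Y ≫ flatMap g Y := by
  simp [flatMap]

/-- Flattening onto an accumulated list `Y` sends both bracketings to the same list by definition,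
so comparison with an identity makes sense. The same holds for the unitors below. -/
theorem flatMap_associator (A B D : SLe V) (Y : List (V × V)) :
    flatMap (α_ A B D).hom Y = 𝟙 (ofList (Formula.flatten A (Formula.flatten B
      (Formula.flatten D Y)))) := by
  have e : (α_ (A ⊗ B) D _ ≪≫ whiskerLeftIso (A ⊗ B) (flattenIso D Y) ≪≫
      α_ A B _ ≪≫ whiskerLeftIso A (flattenIso B _) ≪≫ flattenIso A _).inv ≫
      (α_ A B D).hom ▷ ofList Y ≫ (α_ A (B ⊗ D) _ ≪≫ whiskerLeftIso A (α_ B D _ ≪≫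
      whiskerLeftIso B (flattenIso D Y) ≪≫ flattenIso B _) ≪≫ flattenIso A _).hom = 𝟙 _ := by
    simp
  exact e

theorem flatMap_leftUnitor (A : SLe V) (Y : List (V × V)) :
    flatMap (λ_ A).hom Y = 𝟙 (ofList (Formula.flatten A Y)) := by
  have e (f : A ⊗ ofList Y ≅ ofList (Formula.flatten A Y)) :
      (α_ _ A _ ≪≫ whiskerLeftIso _ f ≪≫ λ_ _).inv ≫ (λ_ A).hom ▷ ofList Y ≫ f.hom = 𝟙 _ := by
    simp
  exact e _

theorem flatMap_rightUnitor (A : SLe V) (Y : List (V × V)) :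
    flatMap (ρ_ A).hom Y = 𝟙 (ofList (Formula.flatten A Y)) := by
  have e (f : A ⊗ ofList Y ≅ ofList (Formula.flatten A Y)) :
      (α_ A _ _ ≪≫ whiskerLeftIso _ (λ_ _) ≪≫ f).inv ≫ (ρ_ A).hom ▷ ofList Y ≫ f.hom = 𝟙 _ := by
    simp
  exact e _

/-- Functoriality of `flatMap` forces its value at the inverse; used for `b^→`, `δ^←` and `σ^←`. -/
theorem flatMap_inv {A B : SLe V} {f : A ≅ B} {Y : List (V × V)}
    {i : ofList (Formula.flatten A Y) ⟶ ofList (Formula.flatten B Y)}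
    {j : ofList (Formula.flatten B Y) ⟶ ofList (Formula.flatten A Y)}
    (h : flatMap f.hom Y = i) (hij : i ≫ j = 𝟙 _) : flatMap f.inv Y = j := by
  subst h
  have e : flatMap f.inv Y ≫ flatMap f.hom Y = 𝟙 _ := by
    rw [← flatMap_comp, f.inv_hom_id, flatMap_id]
  rw [← Category.comp_id (flatMap f.inv Y), ← hij, ← Category.assoc, e, Category.id_comp]

/-- Existence of normal forms. Coherence isomorphisms flatten to identities, while `r`, `t` and `c`
become the generators treated above. The list `Y` is arbitrary because in `f ∧ g` the arrow `f` acts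
in front of the flattened target of `g`. -/
theorem preservesNormal_flatMap {A B : Formula V} (f : ArrowTerm A B) :
    ∀ Y : List (V × V), PreservesNormal (flatMap (ofTerm f) Y) := by
  induction f with
  | one A =>
    intro Y
    exact (PreservesNormal.id _).congr (flatMap_id _ Y).symm
  | bR A B C =>
    exact fun Y => (PreservesNormal.id _).congr
      (flatMap_inv (flatMap_associator _ _ _ Y) (Category.comp_id _)).symm
  | bL A B C => exact fun Y => (PreservesNormal.id _).congr (flatMap_associator _ _ _ Y).symm
  | deltaR A => exact fun Y => (PreservesNormal.id _).congr (flatMap_rightUnitor (show SLe V from A) Y).symm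
  | deltaL A =>
    exact fun Y => (PreservesNormal.id _).congr
      (flatMap_inv (flatMap_rightUnitor (show SLe V from A) Y) (Category.comp_id _)).symm
  | sigmaR A => exact fun Y => (PreservesNormal.id _).congr (flatMap_leftUnitor (show SLe V from A) Y).symm
  | sigmaL A =>
    exact fun Y => (PreservesNormal.id _).congr
      (flatMap_inv (flatMap_leftUnitor (show SLe V from A) Y) (Category.comp_id _)).symm
  | r x =>
    intro Y
    have e : introRefl x (ofList Y) = (λ_ _).inv ≫ rArrow x ▷ ofList Y ≫ 𝟙 _ := by
      simp [introRefl]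
    exact (preservesNormal_introRefl x Y).congr e
  | t x y z =>
    intro Y
    have e : composeFirst x y z (ofList Y) =
        (α_ _ _ _ ≪≫ whiskerLeftIso _ (Iso.refl _) ≪≫ Iso.refl _).inv ≫
          tArrow x y z ▷ ofList Y ≫ 𝟙 _ := by
      simp [composeFirst]
    exact (preservesNormal_composeFirst x y z Y).congr e
  | c A B =>
    exact fun Y => (preservesNormal_flatExchange A B Y).congr (flatMap_braiding _ _ Y).symm
  | and f g ihf ihg =>
    exact fun Y => ((preservesNormal_flatWhisker _ (ihg Y)).comp (ihf _)).congr
      (flatMap_tensor _ _ Y).symm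
  | comp g f ihg ihf =>
    exact fun Y => ((ihf Y).comp (ihg Y)).congr (flatMap_comp _ _ Y).symm

/-- On the empty list, `flatMap f` is `f ▷ 𝟙_` conjugated by isomorphisms, and whiskering by the
unit is faithful. -/
theorem flatMap_injective {A B : SLe V} {f g : A ⟶ B} (h : flatMap f [] = flatMap g []) :
    f = g := by
  have h1 : f ▷ 𝟙_ (SLe V) = g ▷ 𝟙_ _ := by
    rwa [flatMap, flatMap, cancel_epi, cancel_mono] at h
  exact (whiskerRight_iff f g).1 h1

end SLe

/-! ## The relation of an arrow -/

/-- Assignments of truth values to the occurrences of variables in a formula. -/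
def Formula.Valuation {V : Type*} : Formula V → Type
  | .le _ _ => Prop × Prop
  | .top => Unit
  | .conj A B => A.Valuation × B.Valuation

/-- The assignments of truth values to the occurrences of variables, as functions on an ordinal. -/
def Formula.valuationEquiv {V : Type*} : ∀ A : Formula V, A.Valuation ≃ (Fin A.size → Prop)
  | .le _ _ => (finTwoArrowEquiv Prop).symm
  | .top => Equiv.ofUnique Unit (Fin 0 → Prop)
  | .conj A B => (A.valuationEquiv.prodCongr B.valuationEquiv).trans (Fin.appendEquiv _ _)

namespace BrHom

theorem inv_tensor_append {m n m' n' : ℕ} (R : BrHom m n) (P : BrHom m' n') (f : Fin m → Prop)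
    (f' : Fin m' → Prop) (g : Fin n → Prop) (g' : Fin n' → Prop) :
    Inv (tensor R P) (Fin.append f f') (Fin.append g g') ↔ Inv R f g ∧ Inv P f' g' := by
  simp only [inv_tensor, Fin.append_left, Fin.append_right]

theorem append_assoc_comp {m n k : ℕ} (f : Fin m → Prop) (g : Fin n → Prop) (h : Fin k → Prop) :
    Fin.append (Fin.append f g) h ∘ finCongr (Nat.add_assoc m n k).symm =
      Fin.append f (Fin.append g h) := by
  rw [Fin.append_assoc]
  rfl

theorem append_zero_comp {m : ℕ} (u : Fin 0 → Prop) (f : Fin m → Prop) :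
    Fin.append u f ∘ finCongr (Nat.zero_add m).symm = f := by
  rw [Fin.append_left_nil u f rfl]
  rfl

theorem append_comp_finAddFlip {m n : ℕ} (f : Fin m → Prop) (g : Fin n → Prop) :
    Fin.append g f ∘ finAddFlip = Fin.append f g := by
  funext i
  refine Fin.addCases (fun i => ?_) (fun i => ?_) i <;> simp

end BrHom

namespace SLe

variable {V : Type*}

/-- The assignments of truth values to the occurrences of variables in a formula. -/
abbrev Val (A : SLe V) : Type := Formula.Valuation A

/-- The pairs of assignments that respect the diagram of an arrow. -/
def Rel {A B : SLe V} (f : A ⟶ B) (a : Val A) (b : Val B) : Prop :=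
  BrHom.Inv ((toBr V).map f) (Formula.valuationEquiv A a) (Formula.valuationEquiv B b)

theorem rel_eq_of_map_eq {A B : SLe V} {f g : A ⟶ B} (h : (toBr V).map f = (toBr V).map g) :
    Rel f = Rel g := by
  funext a b
  rw [Rel, Rel, h]

theorem rel_comp {A B C : SLe V} (f : A ⟶ B) (g : B ⟶ C) (a : Val A) (c : Val C) :
    Rel (f ≫ g) a c ↔ ∃ b, Rel f a b ∧ Rel g b c := by
  rw [Rel, Functor.map_comp]
  exact BrHom.inv_comp.trans (Formula.valuationEquiv B).surjective.exists

theorem rel_id (A : SLe V) (a b : Val A) : Rel (𝟙 A) a b ↔ a = b :=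
  BrHom.inv_ofEquiv.trans (Formula.valuationEquiv A).injective.eq_iff

theorem rel_tensor {A B C D : SLe V} (f : A ⟶ B) (g : C ⟶ D) (a : Val A) (b : Val B) (c : Val C)
    (d : Val D) : Rel (f ⊗ₘ g) (a, c) (b, d) ↔ Rel f a b ∧ Rel g c d := by
  obtain ⟨f, rfl⟩ := ofTerm_surjective f
  obtain ⟨g, rfl⟩ := ofTerm_surjective g
  exact BrHom.inv_tensor_append _ _ _ _ _ _

theorem rel_whiskerLeft (A : SLe V) {B C : SLe V} (f : B ⟶ C) (a a' : Val A) (b : Val B)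
    (c : Val C) : Rel (A ◁ f) (a, b) (a', c) ↔ a = a' ∧ Rel f b c := by
  rw [← id_tensorHom, rel_tensor, rel_id]

theorem rel_whiskerRight {A B : SLe V} (f : A ⟶ B) (C : SLe V) (a : Val A) (b : Val B)
    (c c' : Val C) : Rel (f ▷ C) (a, c) (b, c') ↔ Rel f a b ∧ c = c' := by
  rw [← tensorHom_id, rel_tensor, rel_id]

theorem rel_associator_inv (A B C : SLe V) (a a' : Val A) (b b' : Val B) (c c' : Val C) :
    Rel (α_ A B C).inv (a, (b, c)) ((a', b'), c') ↔ a = a' ∧ b = b' ∧ c = c' := by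
  refine BrHom.inv_ofEquiv.trans ?_
  refine (Eq.congr_right (BrHom.append_assoc_comp _ _ _)).trans
    (((Formula.valuationEquiv (.conj A (.conj B C))).injective.eq_iff (b := (a', (b', c')))).trans
      ?_)
  exact Prod.mk_inj.trans (and_congr_right fun _ => Prod.mk_inj)

theorem rel_associator_hom (A B C : SLe V) (a a' : Val A) (b b' : Val B) (c c' : Val C) :
    Rel (α_ A B C).hom ((a, b), c) (a', (b', c')) ↔ a = a' ∧ b = b' ∧ c = c' := by
  refine BrHom.inv_ofEquiv.trans ((Eq.congr_right (Fin.append_assoc _ _ _).symm).trans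
    (((Formula.valuationEquiv (.conj (.conj A B) C)).injective.eq_iff
      (b := ((a', b'), c'))).trans ?_))
  exact Prod.mk_inj.trans ((and_congr_left fun _ => Prod.mk_inj).trans and_assoc)

theorem rel_leftUnitor_inv (A : SLe V) (a a' : Val A) (u : Val (𝟙_ (SLe V))) :
    Rel (λ_ A).inv a (u, a') ↔ a = a' := by
  refine BrHom.inv_ofEquiv.trans ?_
  exact (Eq.congr_right (BrHom.append_zero_comp (Formula.valuationEquiv (V := V) .top u) _)).trans
    (Formula.valuationEquiv _).injective.eq_iff

theorem rel_braiding (A B : SLe V) (a a' : Val A) (b b' : Val B) :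
    Rel (β_ A B).hom (a, b) (b', a') ↔ a = a' ∧ b = b' := by
  refine BrHom.inv_ofEquiv.trans ?_
  refine (Eq.congr_right (BrHom.append_comp_finAddFlip _ _)).trans
    (((Formula.valuationEquiv (.conj A B)).injective.eq_iff (b := (a', b'))).trans ?_)
  exact Prod.mk_inj

theorem rel_rArrow (x : V) (u : Val (𝟙_ (SLe V))) (p q : Prop) :
    Rel (rArrow x) u (p, q) ↔ p = q := BrHom.inv_cap

theorem rel_tArrow (x y z : V) (p q p' q' p'' q'' : Prop) :
    Rel (tArrow x y z) ((p, q), (p', q')) (p'', q'') ↔ p = p'' ∧ q = p' ∧ q' = q'' :=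
  BrHom.inv_cup

theorem rel_exchange (A B X : SLe V) (a a' : Val A) (b b' : Val B) (v v' : Val X) :
    Rel (exchange A B X) (a, (b, v)) (b', (a', v')) ↔ a = a' ∧ b = b' ∧ v = v' := by
  have h1 : Rel ((β_ A B).hom ▷ X ≫ (α_ B A X).hom) ((a, b), v) (b', (a', v')) ↔
      a = a' ∧ b = b' ∧ v = v' := by
    refine (rel_comp _ _ _ _).trans ?_
    constructor
    · rintro ⟨⟨⟨b'', a''⟩, v''⟩, h1, h2⟩
      obtain ⟨h3, rfl⟩ := (rel_whiskerRight _ _ _ _ _ _).1 h1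
      obtain ⟨rfl, rfl⟩ := (rel_braiding _ _ _ _ _ _).1 h3
      obtain ⟨h4, h5, h6⟩ := (rel_associator_hom _ _ _ _ _ _ _ _ _).1 h2
      exact ⟨h5, h4, h6⟩
    · rintro ⟨rfl, rfl, rfl⟩
      exact ⟨((b, a), v), (rel_whiskerRight _ _ _ _ _ _).2
        ⟨(rel_braiding _ _ _ _ _ _).2 ⟨rfl, rfl⟩, rfl⟩,
          (rel_associator_hom _ _ _ _ _ _ _ _ _).2 ⟨rfl, rfl, rfl⟩⟩
  refine (rel_comp _ _ _ _).trans (Iff.trans ⟨?_, fun h => ?_⟩ h1)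
  · rintro ⟨⟨⟨a'', b''⟩, v''⟩, h2, h3⟩
    obtain ⟨rfl, rfl, rfl⟩ := (rel_associator_inv _ _ _ _ _ _ _ _ _).1 h2
    exact h3
  · exact ⟨((a, b), v), (rel_associator_inv _ _ _ _ _ _ _ _ _).2 ⟨rfl, rfl, rfl⟩, h⟩

theorem rel_introRefl (x : V) (A : SLe V) (a a' : Val A) (p q : Prop) :
    Rel (introRefl x A) a ((p, q), a') ↔ p = q ∧ a = a' := by
  refine (rel_comp _ _ _ _).trans ?_
  constructor
  · rintro ⟨⟨u, b⟩, h1, h2⟩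
    obtain rfl := (rel_leftUnitor_inv _ _ _ _).1 h1
    obtain ⟨h3, rfl⟩ := (rel_whiskerRight _ _ _ _ _ _).1 h2
    exact ⟨(rel_rArrow _ _ _ _).1 h3, rfl⟩
  · rintro ⟨h, rfl⟩
    exact ⟨((), a), (rel_leftUnitor_inv _ _ _ _).2 rfl,
      (rel_whiskerRight _ _ _ _ _ _).2 ⟨(rel_rArrow _ _ _ _).2 h, rfl⟩⟩

theorem rel_composeFirst (x y z : V) (A : SLe V) (p q p' q' p'' q'' : Prop) (a a' : Val A) :
    Rel (composeFirst x y z A) ((p, q), ((p', q'), a)) ((p'', q''), a') ↔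
      (p = p'' ∧ q = p' ∧ q' = q'') ∧ a = a' := by
  refine (rel_comp _ _ _ _).trans ?_
  constructor
  · rintro ⟨⟨⟨b, c⟩, d⟩, h1, h2⟩
    obtain ⟨rfl, rfl, rfl⟩ := (rel_associator_inv _ _ _ _ _ _ _ _ _).1 h1
    obtain ⟨h3, h4⟩ := (rel_whiskerRight _ _ _ _ _ _).1 h2
    exact ⟨(rel_tArrow _ _ _ _ _ _ _ _ _).1 h3, h4⟩
  · rintro ⟨h, h'⟩
    exact ⟨(((p, q), (p', q')), a), (rel_associator_inv _ _ _ _ _ _ _ _ _).2 ⟨rfl, rfl, rfl⟩,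
      (rel_whiskerRight _ _ _ _ _ _).2 ⟨(rel_tArrow _ _ _ _ _ _ _ _ _).2 h, h'⟩⟩

/-! ### Assignments and insertions -/

/-- Inserts an assignment for an inserted atomic formula. -/
def insertVal {a : V × V} : ∀ {X X' : List (V × V)}, Insertion a X X' → Prop × Prop →
    Val (ofList X) → Val (ofList X')
  | _, _, .here _, p, v => (p, v)
  | _, _, .there _ i, p, v => (v.1, insertVal i p v.2)

/-- The assignment that is false everywhere. -/
def falseVal : ∀ X : List (V × V), Val (ofList X)
  | [] => ()
  | _ :: X => ((False, False), falseVal X)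

/-- The position of an insertion. -/
def insertionPos {a : V × V} : ∀ {X X' : List (V × V)}, Insertion a X X' → ℕ
  | _, _, .here _ => 0
  | _, _, .there _ i => insertionPos i + 1

theorem insertion_eq_of_pos : ∀ {a b : V × V} {X W X' : List (V × V)} (i : Insertion a X X')
    (j : Insertion b W X'), insertionPos i = insertionPos j → a = b ∧ X = W ∧ HEq i j
  | _, _, _, _, _, .here _, .here _, _ => ⟨rfl, rfl, HEq.rfl⟩
  | _, _, _, _, _, .there _ i, .there _ j, h => by
    obtain ⟨rfl, rfl, h⟩ := insertion_eq_of_pos i j (Nat.succ.inj h)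
    cases h
    exact ⟨rfl, rfl, HEq.rfl⟩

theorem insertVal_falseVal {a : V × V} : ∀ {X X' : List (V × V)} (i : Insertion a X X'),
    insertVal i (False, False) (falseVal X) = falseVal X'
  | _, _, .here _ => rfl
  | _, _, .there _ i => congrArg (Prod.mk (False, False)) (insertVal_falseVal i)

theorem insertVal_ne_falseVal {a : V × V} {q : Prop × Prop} (hq : q.1) :
    ∀ {X X' : List (V × V)} (i : Insertion a X X') (c : Val (ofList X)),
    insertVal i q c ≠ falseVal X'
  | _, _, .here _, c, h => by
    have h1 : q = (False, False) := congrArg Prod.fst h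
    rw [h1] at hq
    exact hq
  | _, _, .there _ i, c, h => insertVal_ne_falseVal hq i c.2 (congrArg Prod.snd h)

theorem insertVal_injective {a : V × V} : ∀ {X X' : List (V × V)} (i : Insertion a X X')
    {p q : Prop × Prop} {v w : Val (ofList X)}, insertVal i p v = insertVal i q w → p = q ∧ v = w
  | _, _, .here _, _, _, _, _, h => Prod.mk.inj h
  | _, _, .there _ i, _, _, (_, _), (_, _), h =>
    have h1 := Prod.mk.inj h
    have h2 := insertVal_injective i h1.2
    ⟨h2.1, Prod.ext h1.1 h2.2⟩

/-- On the left the only atom whose first value can be true is the one inserted by `i`; on the right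
the atom inserted by `j` has this property. -/
theorem insertionPos_eq_of_insertVal_eq : ∀ {a b : V × V} {X W X' : List (V × V)}
    (i : Insertion a X X') (j : Insertion b W X') {p q : Prop × Prop} {c : Val (ofList W)},
    p.1 → q.1 → insertVal i p (falseVal X) = insertVal j q c → insertionPos i = insertionPos j
  | _, _, _, _, _, .here _, .here _, _, _, _, _, _, _ => rfl
  | _, _, _, _, _, .here _, .there _ j, _, _, _, _, hq, h =>
    absurd (congrArg Prod.snd h).symm (insertVal_ne_falseVal hq j _)
  | _, _, _, _, _, .there _ i, .here _, _, q, _, _, hq, h => by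
    have h1 : (False, False) = q := congrArg Prod.fst h
    rw [← h1] at hq
    exact hq.elim
  | _, _, _, _, _, .there _ i, .there _ j, _, _, _, hp, hq, h =>
    congrArg Nat.succ (insertionPos_eq_of_insertVal_eq i j hp hq (congrArg Prod.snd h))

theorem rel_insertionHom {a : V × V} : ∀ {X X' : List (V × V)} (i : Insertion a X X')
    (u : Val (ofList X')) (p : Prop × Prop) (v : Val (ofList X)),
    Rel (insertionHom i) u (p, v) ↔ u = insertVal i p v
  | _, _, .here _, u, p, v => rel_id _ _ _
  | _, _, .there b (X := X) (X' := X') i, (q, u), p, (q', v) => by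
    refine (rel_comp _ _ _ _).trans ?_
    constructor
    · rintro ⟨⟨q'', p', w⟩, h1, h2⟩
      obtain ⟨rfl, h3⟩ := (rel_whiskerLeft _ _ _ _ _ _).1 h1
      obtain ⟨rfl, rfl, rfl⟩ := (rel_exchange _ _ _ _ _ _ _ _ _).1 h2
      exact congrArg (Prod.mk q) ((rel_insertionHom i _ _ _).1 h3)
    · intro h
      obtain ⟨rfl, h⟩ := Prod.mk.inj h
      exact ⟨(q, (p, v)), (rel_whiskerLeft _ _ _ _ _ _).2 ⟨rfl, (rel_insertionHom i _ _ _).2 h⟩,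
        (rel_exchange _ _ _ _ _ _ _ _ _).2 ⟨rfl, rfl, rfl⟩⟩

theorem rel_refl {x : V} {X Y : List (V × V)} (f : NormalForm X Y) (u : Val (ofList X))
    (p q : Prop) (v : Val (ofList Y)) :
    Rel (normalHom (.refl x f)) u ((p, q), v) ↔ p = q ∧ Rel (normalHom f) u v := by
  refine (rel_comp _ _ _ _).trans ?_
  constructor
  · rintro ⟨⟨⟨p', q'⟩, w⟩, h1, h2⟩
    obtain ⟨h3, h4⟩ := (rel_whiskerLeft _ _ _ _ _ _).1 h2
    cases h3
    obtain ⟨h5, rfl⟩ := (rel_introRefl _ _ _ _ _ _).1 h1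
    exact ⟨h5, h4⟩
  · rintro ⟨h, h'⟩
    exact ⟨((p, q), u), (rel_introRefl _ _ _ _ _ _).2 ⟨h, rfl⟩,
      (rel_whiskerLeft _ _ _ _ _ _).2 ⟨rfl, h'⟩⟩

theorem rel_trans {x y z : V} {X X' Y : List (V × V)} (i : Insertion (x, y) X X')
    (f : NormalForm X ((y, z) :: Y)) (u : Val (ofList X')) (p q : Prop) (v : Val (ofList Y)) :
    Rel (normalHom (.trans i f)) u ((p, q), v) ↔ ∃ (r : Prop) (w : Val (ofList X)),
      u = insertVal i (p, r) w ∧ Rel (normalHom f) w ((r, q), v) := by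
  refine (rel_comp _ _ _ _).trans ?_
  constructor
  · rintro ⟨⟨⟨p', r⟩, w⟩, h1, h2⟩
    obtain ⟨⟨⟨p'', r'⟩, ⟨⟨s, q'⟩, v'⟩⟩, h3, h4⟩ := (rel_comp _ _ _ _).1 h2
    obtain ⟨⟨rfl, rfl, rfl⟩, rfl⟩ := (rel_composeFirst _ _ _ _ _ _ _ _ _ _ _ _).1 h4
    obtain ⟨h5, h6⟩ := (rel_whiskerLeft _ _ _ _ _ _).1 h3
    cases h5
    exact ⟨r, w, (rel_insertionHom _ _ _ _).1 h1, h6⟩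
  · rintro ⟨r, w, h1, h2⟩
    exact ⟨((p, r), w), (rel_insertionHom _ _ _ _).2 h1, (rel_comp _ _ _ _).2
      ⟨((p, r), ((r, q), v)), (rel_whiskerLeft _ _ _ _ _ _).2 ⟨rfl, h2⟩,
        (rel_composeFirst _ _ _ _ _ _ _ _ _ _ _ _).2 ⟨⟨rfl, rfl, rfl⟩, rfl⟩⟩⟩

/-! ### Normal forms are determined by their relations -/

/-- A constant assignment respects every diagram. It serves as the background against which a single
line is made true. -/
theorem rel_falseVal : ∀ {X Y : List (V × V)} (f : NormalForm X Y),
    Rel (normalHom f) (falseVal X) (falseVal Y)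
  | _, _, .nil => (rel_id _ _ _).2 rfl
  | _, _, .refl _ f => (rel_refl f _ _ _ _).2 ⟨rfl, rel_falseVal f⟩
  | _, _, .trans i f =>
    (rel_trans i f _ _ _ _).2 ⟨False, falseVal _, (insertVal_falseVal i).symm, rel_falseVal f⟩

/-- A cap at the head atom forces its two values to agree. If the chain has a first link, the left
value can be true alone, along the line to that link. -/
theorem rel_refl_ne_rel_trans {x y : V} {X X' Y : List (V × V)} (f : NormalForm X' Y)
    (i : Insertion (x, y) X X') (g : NormalForm X ((y, x) :: Y)) :
    Rel (normalHom (.refl x f)) ≠ Rel (normalHom (.trans i g)) := by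
  intro h
  have h1 : Rel (normalHom (.trans i g)) (insertVal i (True, False) (falseVal X))
      ((True, False), falseVal Y) :=
    (rel_trans i g _ _ _ _).2 ⟨False, falseVal X, rfl, rel_falseVal g⟩
  rw [← h] at h1
  exact ((rel_refl f _ _ _ _).1 h1).1.mp trivial

theorem normalForm_eq_of_rel_eq {X Y : List (V × V)} (f g : NormalForm X Y)
    (h : Rel (normalHom f) = Rel (normalHom g)) : f = g := by
  induction f with
  | nil => cases g; rfl
  | refl x f ih =>
    cases g with
    | refl _ g =>
      rw [ih g]
      funext u v
      -- Any head assignment with equal values satisfies the condition of the cap, leaving only the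
      -- relation of the tail.
      have h1 := congrFun (congrFun h u) ((True, True), v)
      rw [rel_refl, rel_refl] at h1
      simpa using h1
    | trans j g => exact absurd h (rel_refl_ne_rel_trans f j g)
  | @trans x y z X X' Y i f ih =>
    cases g with
    | refl _ g => exact absurd h.symm (rel_refl_ne_rel_trans g i f)
    | @trans _ y' _ W _ _ j g =>
      -- Only the line from the left variable of the first target atom is made true. Its other end
      -- is the left variable of the first link, in both normal forms.
      have hpos : insertionPos i = insertionPos j := by
        have h1 : Rel (normalHom (.trans i f)) (insertVal i (True, False) (falseVal X))
            ((True, False), falseVal Y) :=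
          (rel_trans i f _ _ _ _).2 ⟨False, falseVal X, rfl, rel_falseVal f⟩
        rw [h] at h1
        obtain ⟨r, w, h2, -⟩ := (rel_trans j g _ _ _ _).1 h1
        exact insertionPos_eq_of_insertVal_eq i j (p := (True, False)) (q := (True, r))
          trivial trivial h2
      -- Both insertions end in the same list, so the common position fixes the atom, hence the
      -- middle variable of the link, as well as the remaining list.
      obtain ⟨h1, rfl, h2⟩ := insertion_eq_of_pos i j hpos
      cases h1
      cases h2
      rw [ih g]
      -- With the value on the peeled line fixed, injectivity of `insertVal` recovers the relation
      -- of the rest from that of the whole.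
      have key : ∀ (f : NormalForm X ((y, z) :: Y)) (u : Val (ofList X)) (p q : Prop)
          (v : Val (ofList Y)), Rel (normalHom (.trans i f)) (insertVal i (True, p) u)
            ((True, q), v) ↔ Rel (normalHom f) u ((p, q), v) := by
        intro f u p q v
        rw [rel_trans]
        constructor
        · rintro ⟨r, w, h1, h2⟩
          obtain ⟨h3, rfl⟩ := insertVal_injective i h1
          cases h3
          exact h2
        · intro h
          exact ⟨p, u, rfl, h⟩
      funext u ⟨⟨p, q⟩, v⟩
      exact propext (((key f u p q v).symm.trans (by rw [h])).trans (key g u p q v))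

/-- Ensures that the diagram of `flatMap f` depends on `f` only through the diagram of `f`. -/
theorem map_whiskerRight {A B : SLe V} (f : A ⟶ B) (C : SLe V) :
    (toBr V).map (f ▷ C) =
      BrHom.tensor ((toBr V).map f) (BrHom.ofEquiv (Equiv.refl (Fin (Formula.size C)))) := by
  obtain ⟨f, rfl⟩ := ofTerm_surjective f
  rfl

theorem eq_of_map_eq {A B : SLe V} {f g : A ⟶ B} (h : (toBr V).map f = (toBr V).map g) :
    f = g := by
  obtain ⟨f', rfl⟩ := ofTerm_surjective f
  obtain ⟨g', rfl⟩ := ofTerm_surjective g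
  apply flatMap_injective
  obtain ⟨m, hm⟩ := (preservesNormal_flatMap f' []).isNormal
  obtain ⟨n, hn⟩ := (preservesNormal_flatMap g' []).isNormal
  have hmn : m = n := by
    apply normalForm_eq_of_rel_eq
    apply rel_eq_of_map_eq
    rw [hm, hn]
    rw [flatMap, flatMap]
    simp only [Functor.map_comp, map_whiskerRight, h]
  exact hm.symm.trans ((congrArg normalHom hmn).trans hn)

end SLe

/-- Coherence of `S_≤`: for every set `V` of variables, the functor `G` from `S_≤` to `Br` is
faithful. -/
theorem mainTheorem2 (V : Type*) : (SLe.toBr V).Faithful :=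
  ⟨fun h => SLe.eq_of_map_eq h⟩
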